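/- **Timed automata.** Fix sets $AP$ (propositions) and $Act$ (events), a finite nonempty set $X$ of clocks and a finite set $Int$ of integer variables; $n\in Int$ ranges over a set $D_n\subseteq\mathbb Z$ and has initial value $v^0_{var}(n)$. A clock constraint is a finite conjunction of literals $x\sim d$, $\neg(x\sim d)$ with $x\in X$, $d\in\mathbb N$, $\sim\in\{<,=,>\}$; a variable constraint is a Boolean combination of atoms $n\sim c$, $n\sim n'$ with $\sim\in\{<,=\}$. A network $\mathcal N$ consists of automata $\mathcal A_1,\dots,\mathcal A_K$. Each $\mathcal A_k$ has finitely many locations $0,1,\dots$ ($0$ initial), each location $q$ with an invariant $Inv(q)$ (a clock constraint) and a label $L(q)\subseteq AP$, and a finite enumerated family $T_k$ of transitions $q\xrightarrow{\gamma,\xi,\alpha,\zeta,\mu}q'$ with clock guard $\gamma$, variable guard $\xi$, action $\alpha\in\{\tau\}\cup Act\times\{!,?,\#,@,\&,*\}$, set $\zeta\subseteq X$ of reset clocks and finite set $\mu$ of assignments $n:=\exp$. For $v:X\to\mathbb R_{\ge0}$, weak satisfaction $v\models_w$ of a conjunction is literalwise: $x<d$ and $x>d$ are read as $\le,\ge$;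 $x=d$ is false; $\neg(x<d)$, $\neg(x>d)$ are read as usual; $\neg(x=d)$ is true. **Traces.** A configuration $(\mathtt l,v_{var},v)$ consists of a location $\mathtt l[k]$ for each $k$ and valuations $v_{var}:Int\to\mathbb Z$, $v:X\to\mathbb R_{\ge0}$. A time transition $\xrightarrow{\delta}$, $\delta>0$, keeps $\mathtt l,v_{var}$, has $v'=v+\delta$, and requires $v'\models_w Inv(\mathtt l[k])$ for all $k$. A discrete transition $(\mathtt l,v_{var},v)\xrightarrow{\Lambda}(\mathtt l',v'_{var},v')$ has symbols $\Lambda[k]=\_$ or $\Lambda[k]=(\alpha,b)$ with $b\in\{\mathtt{ei},\mathtt{ie}\}$ ($\mathtt{ei}$: open-closed, $\mathtt{ie}$: closed-open). It requires: (a) for each $k$ with $\Lambda[k]=(\alpha,b)$ a transition $\mathtt l[k]\xrightarrow{\gamma,\xi,\alpha,\zeta,\mu}\mathtt l'[k]$ of $\mathcal A_k$ is chosen such that $v\models\gamma$, $v_{var}\models\xi$, $v'=0$ on $\zeta$, $v'_{var}(n)$ equals the value of $\exp$ in $v_{var}$ for each $n:=\exp$ in $\mu$, and, if $b=\mathtt{ei}$,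 $v\models_w Inv(\mathtt l[k])$ and $v'\models Inv(\mathtt l'[k])$, while if $b=\mathtt{ie}$, $v\models Inv(\mathtt l[k])$ and $v'\models_w Inv(\mathtt l'[k])$; (b) for each $k$ with $\Lambda[k]=\_$, $\mathtt l'[k]=\mathtt l[k]$ and $v,v'\models Inv(\mathtt l[k])$; (c) clocks not reset and variables not assigned by any chosen transition keep their values. A trace is an infinite sequence $c_0e_0c_1e_1\dots$ of configurations (variable values in the sets $D_n$) and events $e_i=\delta_i$ or $e_i=\Lambda_i$ with $c_i\xrightarrow{e_i}c_{i+1}$, where $e_0$ is a delay, every discrete transition is followed by a delay, and in $c_0$ all locations are $0$, clocks are $0$, variables have their initial values and all invariants hold. Its alternating form $(\mathtt l_0,v_{var,0},v_0)\xrightarrow{\delta_0}(\mathtt l'_0,v'_{var,0},v'_0)\xrightarrow{\Lambda_0}(\mathtt l_1,v_{var,1},v_1)\xrightarrow{\delta_1}\cdots$ is obtained by inserting, between any two consecutive delays, a discrete transition with $\Lambda[k]=\_$ for all $k$ that leaves the configuration unchanged. **Conditions on traces.** A transition of $\mathcal A_k$ is *enabled* in a configuration if it leaves the current location of $\mathcal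 A_k$ and both its guards hold. *Liveness.* Strong (weak) transition liveness: for each $h$ and every $k$ (resp. some $k$) there is $j>h$ such that the $j$-th event is a discrete transition with $\Lambda[k]\ne\_$. Strong (weak) guard liveness: for each $h$ and every $k$ (resp. some $k$) there is $j>h$ such that the $j$-th event is a delay leading to a configuration in which some transition of $\mathcal A_k$ is enabled. *Synchronization*, for every discrete transition, every $k$ and every $a\in Act$ ("$k$ performs $\alpha$" means $\Lambda[k]=(\alpha,b)$ for some $b$). Channel: if $k$ performs $a!$ then exactly one $k'\ne k$ performs $a?$, and with the same edge $b$ as $k$; and vice versa with $!$ and $?$ exchanged. Broadcast: if $k$ performs $a\#$ then each $k'\neq k$ does not perform $a\#$, and either performs $a@$ with the same edge as $k$ or has no enabled transition labelled $a@$ in the configuration in which the discrete transition is taken; if $k$ performs $a@$ then some $k'\ne k$ performs $a\#$. One-to-many: if $k$ performs $a\&$ then no $k'\ne k$ performs $a\&$ and some $k'\ne k$ performs $a*$; if $k$ performs $a*$ then some $k'\neq k$ performs $a\&$. *Edges.* Closed-open (open-closed): every $\Lambda[k]\ne\_$ has $b=\mathtt{ie}$ (resp. $\mathtt{ei}$).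 Unrestricted: no condition. **CLTLoc$_v$.** Formulae are built from propositions, $x\sim c$ ($x$ a clock, $c\in\mathbb N$), $\exp_1\sim\exp_2$ and $\mathbf X(n)\sim\exp$ ($\sim\in\{<,=\}$) with $\wedge,\neg,\mathbf X,\mathbf U$ ($\mathbf F,\mathbf G,\mathbf R$ as usual). Interpretations $(\pi,\sigma,\iota)$ give at each position $i\in\mathbb N$ a set $\pi(i)$ of propositions, clock values $\sigma(i,\cdot)\ge0$ and integer values $\iota(i,\cdot)$, where for some $\delta_i>0$ with $\sum_i\delta_i=\infty$ every clock satisfies $\sigma(i+1,x)\in\{\sigma(i,x)+\delta_i,0\}$; $\mathbf X(n)\sim\exp$ holds at $i$ iff $\iota(i+1,n)\sim\exp(\iota,i)$. A model of a formula is an interpretation that satisfies it at position $0$. Here the propositions are $AP$ and $\mathrm{edge}[k]$, the clocks are two copies $x_0,x_1$ of each $x\in X$, and the variables are $n\in Int$ (values in $D_n$), $\mathtt l[k]$ (a location of $\mathcal A_k$), $\mathtt t[k]$ (an element of $T_k$, or $\natural$), $\mathtt x_v\in\{0,1\}$. **The formula.** Put $\phi_{x\sim d}=(x_0\sim d\wedge\mathtt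 x_v=0)\vee(x_1\sim d\wedge\mathtt x_v=1)$; $\phi_\gamma$ replaces each $x\sim d$ in $\gamma$ by $\phi_{x\sim d}$; write $Inv(q)$ also for $\phi_{Inv(q)}$, and $Inv_w(q)$ for the translation of $\models_w Inv(q)$. Let $\mathrm{rs}(x)$ be $x_0=0\vee x_1=0$. $r_1(\gamma)$ replaces each literal $\beta$ on $x$ by $\mathrm{rs}(x)\to\beta_{[x\leftarrow0]}$, and $r_2$ replaces it by $((x_0>0\wedge x_1>0)\to\phi_\beta)\wedge(\mathrm{rs}(x)\to\beta_{[x\leftarrow 0]})$ (for $Inv_w$: with weak literals). $\phi_\xi$ translates $\xi$; $\phi_\mu=\bigwedge_{(n:=\exp)\in\mu}\mathbf X(n)=\exp$; $\phi_\zeta=\bigwedge_{x\in\zeta}\mathrm{rs}(x)$. For $t\in T_k$ let $t^-,t^+$ be its source and target. Then $\varphi_{\mathcal N}=\phi_{clock}\wedge\varphi_1\wedge\varphi_2\wedge\varphi_3\wedge\mathbf G(\varphi_4\wedge\dots\wedge\varphi_8)$ with - $\phi_{clock}=\bigwedge_x(x_0=0\wedge x_1>0\wedge\mathtt x_v=0)\wedge\mathbf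 G\bigwedge_{x,\,j\in\{0,1\}}\big(x_j=0\to\mathbf X(x_{1-j}=0\ \mathbf R\ (\mathtt x_v=j\wedge x_j>0))\big)$; - $\varphi_1=\bigwedge_k\mathtt l[k]=0$; $\varphi_2=\bigwedge_n n=v^0_{var}(n)$; $\varphi_3=\bigwedge_{k,q}(\mathtt l[k]=q\to Inv(q))$; - $\varphi_4=\bigwedge_{k,q}\big(\mathtt l[k]=q\wedge\mathtt t[k]=\natural\to\mathbf X(Inv(q)\wedge r_1(Inv(q)))\big)$; - $\varphi_5=\bigwedge_{k,t\in T_k}\big(\mathtt t[k]=t\to\mathtt l[k]=t^-\wedge\phi_\xi\wedge\phi_\mu\wedge\mathbf X(\mathtt l[k]=t^+\wedge\phi_\gamma\wedge\phi_\zeta\wedge\phi_{edge})\big)$, where $\phi_{edge}=(Inv(t^-)\wedge r_2(Inv_w(t^+))\wedge\mathrm{edge}[k])\vee(Inv_w(t^-)\wedge r_2(Inv(t^+))\wedge\neg\mathrm{edge}[k])$; - $\varphi_6=\bigwedge_{k,q\ne q'}\big(\mathtt l[k]=q\wedge\mathbf X(\mathtt l[k]=q')\to\bigvee_{t\in T_k,\,t^-=q,\,t^+=q'}\mathtt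 t[k]=t\big)$; - $\varphi_7=\bigwedge_x\big(\mathbf X\,\mathrm{rs}(x)\to\bigvee_{k,\,t\in T_k\text{ resets }x}\mathtt t[k]=t\big)$; $\varphi_8=\bigwedge_n\big(\neg(\mathbf X(n)=n)\to\bigvee_{k,\,t\in T_k\text{ assigns }n}\mathtt t[k]=t\big)$. For a set $l$ of liveness conditions, $\varphi_l$ is the conjunction over $l$ of: strong transition $\bigwedge_k\mathbf G\mathbf F\bigvee_{t\in T_k}\mathtt t[k]=t$; weak transition $\mathbf G\mathbf F\bigvee_{k,t\in T_k}\mathtt t[k]=t$; strong (weak) guard $\mathbf G\bigwedge_k$ (resp. $\mathbf G\bigvee_k$) $\mathbf F\bigvee_{t\in T_k}(\mathtt l[k]=t^-\wedge\phi_\xi\wedge\mathbf X\phi_\gamma)$. Let $\mathrm{on}(k,\alpha)=\bigvee_{t\in T_k\text{ with action }\alpha}\mathtt t[k]=t$, $\mathrm{but}(S,\alpha)=\bigvee_{g\notin S}\mathrm{on}(g,\alpha)$, $\mathrm{se}(k,h)=\mathbf X(\mathrm{edge}[k]\leftrightarrow\mathrm{edge}[h])$. For a set $s$ of synchronization mechanisms,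 $\varphi_s$ is the conjunction over $s$ of $\mathbf G$ applied to the following, for all $k$, $a$ and all $t\in T_k$ with the indicated action: - channel: for $a!$, $\mathtt t[k]=t\to\bigvee_{h\ne k}(\mathrm{on}(h,a?)\wedge\neg\mathrm{but}(\{k,h\},a?)\wedge\mathrm{se}(k,h))$; for $a?$, $\mathtt t[k]=t\to\bigvee_{h\ne k}(\mathrm{on}(h,a!)\wedge\neg\mathrm{but}(\{k,h\},a!))$; - broadcast: for $a\#$, $\mathtt t[k]=t\to\neg\mathrm{but}(\{k\},a\#)$ and $\mathtt t[k]=t\to\bigwedge_{h\ne k}\big((\mathrm{on}(h,a@)\wedge\mathrm{se}(k,h))\vee\bigwedge_{t'\in T_h\text{ with action }a@}(\mathbf X\neg\phi_{\gamma'}\vee\neg\phi_{\xi'}\vee\mathtt l[h]\ne t'^-)\big)$, with $\gamma',\xi'$ the guards of $t'$; for $a@$, $\mathtt t[k]=t\to\mathrm{but}(\{k\},a\#)$; - one-to-many: for $a\&$, $\mathtt t[k]=t\to\neg\mathrm{but}(\{k\},a\&)\wedge\mathrm{but}(\{k\},a*)$; for $a*$, $\mathtt t[k]=t\to\mathrm{but}(\{k\},a\&)$.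 For a set $\mathit{ef}$ of edge restrictions, $\varphi_{ef}$ is the conjunction over $\mathit{ef}$ of: closed-open $\mathbf G\bigwedge_k(\mathtt t[k]\neq\natural\to\mathbf X\,\mathrm{edge}[k])$; open-closed $\mathbf G\bigwedge_k(\mathtt t[k]\ne\natural\to\mathbf X\neg\mathrm{edge}[k])$; unrestricted $\top$. Put $\Phi_{\mathcal N}=\varphi_{\mathcal N}\wedge\varphi_l\wedge\varphi_s\wedge\varphi_{ef}$. **The mappings.** For a trace $\eta$ with alternating form as above, $\rho(\eta)$ is the set of interpretations with, for all $h,k,x,n,p$: $\iota(h,\mathtt l[k])=\mathtt l_h[k]$; $\iota(h,n)=v_{var,h}(n)$; for $p\in AP$, $p\in\pi(h)$ iff $p\in L(\mathtt l_h[k'])$ for some $k'$; $\sigma(0,x_0)=0<\sigma(0,x_1)$ and $\iota(0,\mathtt x_v)=\iota(1,\mathtt x_v)=0$; with $a=\iota(h+1,\mathtt x_v)$ and $i=1-a$: $\sigma(h+1,x_a)=\sigma(h,x_a)+\delta_h$, and if $v_{h+1}(x)=0$ (that is, $x$ is reset) then $\sigma(h+1,x_i)=0$ and $\iota(h+2,\mathtt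 x_v)=i$, otherwise $\sigma(h+1,x_i)=\sigma(h,x_i)+\delta_h$ and $\iota(h+2,\mathtt x_v)=a$; the values $\iota(h,\mathtt t[k])$ ($\natural$ if $\Lambda_h[k]=\_$) are a choice of transitions performing the discrete transition $\Lambda_h$; and if $\Lambda_h[k]=(\alpha,b)$ then $\mathrm{edge}[k]\in\pi(h+1)$ iff $b=\mathtt{ie}$. Conversely, $\rho^{-1}((\pi,\sigma,\iota))$ is the alternating sequence with $\mathtt l_h[k]=\mathtt l'_h[k]=\iota(h,\mathtt l[k])$; $v_{var,h}(n)=v'_{var,h}(n)=\iota(h,n)$; $v_h(x)=0$ if $\sigma(h,x_0)=0$ or $\sigma(h,x_1)=0$, and otherwise $v_h(x)=\sigma(h,x_a)$ with $a=\iota(h,\mathtt x_v)$; and, with $a=\iota(h+1,\mathtt x_v)$, $v'_h(x)=\sigma(h+1,x_a)$ and $\delta_h=\sigma(h+1,x_a)-\sigma(h,x_a)$ for a fixed clock $x$; $\Lambda_h[k]=\_$ if $\iota(h,\mathtt t[k])=\natural$, and otherwise $\Lambda_h[k]=(\alpha,b)$ with $\alpha$ the action of $\iota(h,\mathtt t[k])$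 and $b=\mathtt{ie}$ iff $\mathrm{edge}[k]\in\pi(h+1)$. **Theorem.** Let $\mathcal N$ be a network of timed automata, $l$ a set of liveness conditions, $s$ a set of synchronization mechanisms and $\mathit{ef}$ a set of edge restrictions. For every trace $\eta$ of $\mathcal N$ that satisfies all conditions in $l$, $s$ and $\mathit{ef}$, every $(\pi,\sigma,\iota)\in\rho(\eta)$ is a model of $\Phi_{\mathcal N}$. Conversely, for every model $(\pi,\sigma,\iota)$ of $\Phi_{\mathcal N}$, $\rho^{-1}((\pi,\sigma,\iota))$ is a trace of $\mathcal N$ that satisfies all conditions in $l$, $s$ and $\mathit{ef}$. -/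

import Mathlib

open scoped NNReal

namespace TimedNet

/-! ## Constraint LTL over clocks with integer variables -/

/-- Arithmetic expressions over integer variables `W` and integer constants. -/
inductive Expr (W : Type*) where
  | const (c : ℤ)
  | var (n : W)
  | add (a b : Expr W)
  | sub (a b : Expr W)
  | mul (a b : Expr W)

namespace Expr

/-- Value of an expression under a valuation of the variables. -/
def eval {W : Type*} (v : W → ℤ) : Expr W → ℤ
  | const c => c
  | var n => v n
  | add a b => a.eval v + b.eval v
  | sub a b => a.eval v - b.eval v
  | mul a b => a.eval v * b.eval v

/-- Renaming of the variables of an expression. -/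
def map {W W' : Type*} (f : W → W') : Expr W → Expr W'
  | const c => const c
  | var n => var (f n)
  | add a b => add (a.map f) (b.map f)
  | sub a b => sub (a.map f) (b.map f)
  | mul a b => mul (a.map f) (b.map f)

end Expr

/-- The two primitive comparisons `<` and `=`. -/
inductive CRel where
  | lt
  | eq

/-- Meaning of a primitive comparison. -/
def CRel.holds {α : Type*} [LT α] : CRel → α → α → Prop
  | lt, a, b => a < b
  | eq, a, b => a = b

/-- Formulae over atomic propositions `P`, clocks `C` and integer variables `W`. -/
inductive Formula (P C W : Type*) where
  /-- an atomic proposition -/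
  | prop (p : P)
  /-- `x ∼ c` for a clock `x` and a natural constant `c` -/
  | clk (x : C) (r : CRel) (c : ℕ)
  /-- `exp₁ ∼ exp₂` -/
  | cmp (e₁ : Expr W) (r : CRel) (e₂ : Expr W)
  /-- `X(n) ∼ exp`: compares the value of `n` in the next position with the present value of `exp` -/
  | nextCmp (n : W) (r : CRel) (e : Expr W)
  | and (φ ψ : Formula P C W)
  | not (φ : Formula P C W)
  | next (φ : Formula P C W)
  | untl (φ ψ : Formula P C W)

namespace Formula

variable {P C W : Type*}

def top : Formula P C W := cmp (.const 0) .eq (.const 0)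
def bot : Formula P C W := not top
def or (φ ψ : Formula P C W) : Formula P C W := not (and (not φ) (not ψ))
def imp (φ ψ : Formula P C W) : Formula P C W := or (not φ) ψ
def iff (φ ψ : Formula P C W) : Formula P C W := and (imp φ ψ) (imp ψ φ)
/-- `F φ` -/
def eventually (φ : Formula P C W) : Formula P C W := untl top φ
/-- `G φ` -/
def globally (φ : Formula P C W) : Formula P C W := not (eventually (not φ))
/-- `φ R ψ` -/
def release (φ ψ : Formula P C W) : Formula P C W := not (untl (not φ) (not ψ))

open Classical in
/-- The truth constant with the truth value of `p`. -/
noncomputable def truth (p : Prop) : Formula P C W := if p then top else bot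

/-- Finite conjunction `⋀_{i ∈ s} f i`. -/
noncomputable def all {ι : Type*} (s : Finset ι) (f : ι → Formula P C W) : Formula P C W :=
  (s.toList.map f).foldr and top

/-- Finite disjunction `⋁_{i ∈ s} f i`. -/
noncomputable def any {ι : Type*} (s : Finset ι) (f : ι → Formula P C W) : Formula P C W :=
  (s.toList.map f).foldr or bot

end Formula

/-- Clock assignments: in every step all clocks progress by one common positive delay or are
reset to `0`, and the delays sum up to infinity. -/
def IsClockAssignment {C : Type*} (σ : ℕ → C → ℝ≥0) : Prop :=
  ∃ δ : ℕ → ℝ, (∀ i, 0 < δ i) ∧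
    (∀ i x, ((σ (i + 1) x : ℝ) = σ i x + δ i) ∨ σ (i + 1) x = 0) ∧
    Filter.Tendsto (fun n => ∑ i ∈ Finset.range n, δ i) Filter.atTop Filter.atTop

/-- Interpretations `(π, σ, ι)`, where the variable `w` takes its values in `dom w`. -/
structure Interp (P C W : Type*) (dom : W → Set ℤ) where
  /-- `π` -/
  prop : ℕ → Set P
  /-- `σ` -/
  clk : ℕ → C → ℝ≥0
  /-- `ι` -/
  val : ℕ → W → ℤ
  isClock : IsClockAssignment clk
  mem_dom : ∀ i w, val i w ∈ dom w

/-- `(π, σ, ι), i ⊨ φ`. -/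
def Interp.sat {P C W : Type*} {dom : W → Set ℤ} (m : Interp P C W dom) :
    Formula P C W → ℕ → Prop
  | .prop p, i => p ∈ m.prop i
  | .clk x r c, i => r.holds (m.clk i x) (c : ℝ≥0)
  | .cmp e₁ r e₂, i => r.holds (e₁.eval (m.val i)) (e₂.eval (m.val i))
  | .nextCmp n r e, i => r.holds (m.val (i + 1) n) (e.eval (m.val i))
  | .and φ ψ, i => m.sat φ i ∧ m.sat ψ i
  | .not φ, i => ¬ m.sat φ i
  | .next φ, i => m.sat φ (i + 1)
  | .untl φ ψ, i => ∃ j, i ≤ j ∧ m.sat ψ j ∧ ∀ h, i ≤ h → h < j → m.sat φ h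

/-- `(π, σ, ι)` is a model of `φ`. -/
def Interp.IsModel {P C W : Type*} {dom : W → Set ℤ} (m : Interp P C W dom)
    (φ : Formula P C W) : Prop :=
  m.sat φ 0

/-! ## Timed automata with variables and their networks -/

/-- Comparisons `<`, `=`, `>` in clock constraints. -/
inductive ClockRel where
  | lt
  | eq
  | gt

def ClockRel.holds : ClockRel → ℝ≥0 → ℕ → Prop
  | lt, r, d => r < d
  | eq, r, d => r = d
  | gt, r, d => (d : ℝ≥0) < r

/-- The literal `x ∼ d` (`pos = true`) or `¬ (x ∼ d)` (`pos = false`). -/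
structure ClockLit (X : Type*) where
  clock : X
  rel : ClockRel
  bound : ℕ
  pos : Bool

/-- Truth of a literal when the value of its clock is `r`. -/
def ClockLit.holdsAt {X : Type*} (b : ClockLit X) (r : ℝ≥0) : Prop :=
  match b.pos with
  | true => b.rel.holds r b.bound
  | false => ¬ b.rel.holds r b.bound

/-- Weak truth of a literal when the value of its clock is `r`. -/
def ClockLit.weakAt {X : Type*} (b : ClockLit X) (r : ℝ≥0) : Prop :=
  match b.pos, b.rel with
  | true, .lt => r < b.bound ∨ r = b.bound
  | true, .gt => (b.bound : ℝ≥0) < r ∨ r = b.bound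
  | true, .eq => False
  | false, .lt => ¬ r < b.bound
  | false, .gt => ¬ (b.bound : ℝ≥0) < r
  | false, .eq => True

/-- Clock constraints are finite conjunctions of literals. -/
abbrev ClockConstraint (X : Type*) := List (ClockLit X)

/-- `v ⊨ γ`. -/
def ClockConstraint.Sat {X : Type*} (γ : ClockConstraint X) (v : X → ℝ≥0) : Prop :=
  ∀ b ∈ γ, b.holdsAt (v b.clock)

/-- `v ⊨_w γ`. -/
def ClockConstraint.WeakSat {X : Type*} (γ : ClockConstraint X) (v : X → ℝ≥0) : Prop :=
  ∀ b ∈ γ, b.weakAt (v b.clock)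

/-- Constraints on integer variables. -/
inductive VarConstraint (V : Type*) where
  | tt
  | cmpConst (n : V) (r : CRel) (c : ℤ)
  | cmpVar (n : V) (r : CRel) (n' : V)
  | not (ξ : VarConstraint V)
  | and (ξ ξ' : VarConstraint V)

/-- `v ⊨ ξ`. -/
def VarConstraint.Sat {V : Type*} (v : V → ℤ) : VarConstraint V → Prop
  | tt => True
  | cmpConst n r c => r.holds (v n) c
  | cmpVar n r n' => r.holds (v n) (v n')
  | not ξ => ¬ ξ.Sat v
  | and ξ ξ' => ξ.Sat v ∧ ξ'.Sat v

/-- The synchronization primitives `!`, `?`, `#`, `@`, `&`, `*`. -/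
inductive Prim where
  | send
  | recv
  | bcastSend
  | bcastRecv
  | manySend
  | manyRecv

/-- Actions: the null event `τ`, or an event together with a synchronization primitive. -/
inductive Action (Act : Type*) where
  | tau
  | sync (a : Act) (s : Prim)

/-- A transition of an automaton whose locations are `0, …, nLoc - 1`. -/
structure Transition (X Act V : Type*) (nLoc : ℕ) where
  src : Fin nLoc
  tgt : Fin nLoc
  /-- clock guard `γ` -/
  guard : ClockConstraint X
  /-- variable guard `ξ` -/
  varGuard : VarConstraint V
  action : Action Act
  /-- clocks to be reset -/
  resets : Finset X
  /-- the assignments `n := exp` -/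
  assigns : List (V × Expr V)

/-- `U(t)`: the variables assigned by a transition. -/
def Transition.updated {X Act V : Type*} {nLoc : ℕ} (t : Transition X Act V nLoc) : Set V :=
  {n | ∃ a ∈ t.assigns, a.1 = n}

/-- A timed automaton with variables. Locations and transitions are enumerated; location `0` is
the initial one. -/
structure Automaton (AP X Act V : Type*) where
  nLoc : ℕ
  nLoc_pos : 0 < nLoc
  nTrans : ℕ
  inv : Fin nLoc → ClockConstraint X
  label : Fin nLoc → Set AP
  trans : Fin nTrans → Transition X Act V nLoc

/-- A network of `K` timed automata over common propositions, clocks, events and integer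
variables; the variable `n` ranges over `dom n` and has the initial value `var₀ n`. -/
structure Network (AP X Act V : Type*) (K : ℕ) where
  aut : Fin K → Automaton AP X Act V
  dom : V → Set ℤ
  var₀ : V → ℤ

/-- The two kinds of configuration change: `ei` (excluded-included, open-closed) and
`ie` (included-excluded, closed-open). -/
inductive EdgeKind where
  | ei
  | ie

namespace Network

variable {AP X Act V : Type*} {K : ℕ}

/-- Configurations `(l, v_var, v)`. -/
@[ext] structure Config (N : Network AP X Act V K) where
  loc : ∀ k, Fin (N.aut k).nLoc
  var : V → ℤ
  clk : X → ℝ≥0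

/-- Tuples `Λ` of symbols; `none` is the symbol `_` (no transition is taken). -/
abbrev Symbols (_N : Network AP X Act V K) := Fin K → Option (Action Act × EdgeKind)

/-- A choice of at most one transition in each automaton. -/
abbrev Choice (N : Network AP X Act V K) := ∀ k, Option (Fin (N.aut k).nTrans)

/-- Automaton `k` takes its transition `t` with edge `b` in the change from `c` to `c'`. -/
structure Fires (N : Network AP X Act V K) (k : Fin K) (t : Fin (N.aut k).nTrans)
    (b : EdgeKind) (c c' : N.Config) : Prop where
  src : ((N.aut k).trans t).src = c.loc k
  tgt : ((N.aut k).trans t).tgt = c'.loc k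
  guard : ((N.aut k).trans t).guard.Sat c.clk
  varGuard : ((N.aut k).trans t).varGuard.Sat c.var
  resets : ∀ x ∈ ((N.aut k).trans t).resets, c'.clk x = 0
  assigns : ∀ a ∈ ((N.aut k).trans t).assigns, c'.var a.1 = a.2.eval c.var
  inv : match b with
    | .ei => ((N.aut k).inv (c.loc k)).WeakSat c.clk ∧ ((N.aut k).inv (c'.loc k)).Sat c'.clk
    | .ie => ((N.aut k).inv (c.loc k)).Sat c.clk ∧ ((N.aut k).inv (c'.loc k)).WeakSat c'.clk

/-- The discrete transition from `c` to `c'` with symbols `Λ`, performed by the transitions `ts`. -/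
structure DiscreteStepVia (N : Network AP X Act V K) (ts : N.Choice) (c : N.Config)
    (Λ : N.Symbols) (c' : N.Config) : Prop where
  fires : ∀ k t, ts k = some t →
    ∃ b, Λ k = some (((N.aut k).trans t).action, b) ∧ N.Fires k t b c c'
  idle : ∀ k, ts k = none → Λ k = none ∧ c'.loc k = c.loc k ∧
    ((N.aut k).inv (c.loc k)).Sat c.clk ∧ ((N.aut k).inv (c'.loc k)).Sat c'.clk
  keepClk : ∀ x, (∀ k t, ts k = some t → x ∉ ((N.aut k).trans t).resets) → c'.clk x = c.clk x
  keepVar : ∀ n, (∀ k t, ts k = some t → n ∉ ((N.aut k).trans t).updated) → c'.var n = c.var n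

/-- Discrete transitions. -/
def DiscreteStep (N : Network AP X Act V K) (c : N.Config) (Λ : N.Symbols) (c' : N.Config) :
    Prop :=
  ∃ ts, N.DiscreteStepVia ts c Λ c'

/-- Time transitions. -/
structure TimeStep (N : Network AP X Act V K) (c : N.Config) (δ : ℝ) (c' : N.Config) :
    Prop where
  pos : 0 < δ
  loc : c'.loc = c.loc
  var : c'.var = c.var
  clk : ∀ x, (c'.clk x : ℝ) = c.clk x + δ
  inv : ∀ k, ((N.aut k).inv (c.loc k)).WeakSat c'.clk

/-- An event is a delay or a tuple of symbols. -/
inductive Event (N : Network AP X Act V K) where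
  | delay (δ : ℝ)
  | disc (Λ : N.Symbols)

/-- The configuration change `c →ᵉ c'`. -/
def Step (N : Network AP X Act V K) (c : N.Config) (e : N.Event) (c' : N.Config) : Prop :=
  match e with
  | .delay δ => N.TimeStep c δ c'
  | .disc Λ => N.DiscreteStep c Λ c'

/-- Infinite sequences `c₀, e₀, c₁, e₁, …` of configurations and events. -/
structure Run (N : Network AP X Act V K) where
  conf : ℕ → N.Config
  ev : ℕ → N.Event

/-- The `i`-th event is a delay. -/
def Run.IsDelay {N : Network AP X Act V K} (η : N.Run) (i : ℕ) : Prop :=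
  ∃ δ, η.ev i = .delay δ

/-- Traces of the network. -/
structure IsTrace (N : Network AP X Act V K) (η : N.Run) : Prop where
  step : ∀ i, N.Step (η.conf i) (η.ev i) (η.conf (i + 1))
  first : η.IsDelay 0
  initLoc : ∀ k, ((η.conf 0).loc k : ℕ) = 0
  initInv : ∀ k, ((N.aut k).inv ((η.conf 0).loc k)).Sat (η.conf 0).clk
  initClk : ∀ x, (η.conf 0).clk x = 0
  initVar : ∀ n, (η.conf 0).var n = N.var₀ n
  noConsecutive : ∀ i, ¬ η.IsDelay i → η.IsDelay (i + 1)
  memDom : ∀ i n, (η.conf i).var n ∈ N.dom n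

/-! ## Liveness, synchronization and edge restrictions on traces -/

inductive Liveness where
  | strongTransition
  | weakTransition
  | strongGuard
  | weakGuard

inductive SyncKind where
  | channel
  | broadcast
  | oneToMany

inductive EdgeRestriction where
  | closedOpen
  | openClosed
  | unrestricted

/-- The transition `t` of automaton `k` is enabled in `c`: it leaves the current location and its
guards hold. -/
def Enabled (N : Network AP X Act V K) (k : Fin K) (t : Fin (N.aut k).nTrans) (c : N.Config) :
    Prop :=
  ((N.aut k).trans t).src = c.loc k ∧ ((N.aut k).trans t).guard.Sat c.clk ∧
    ((N.aut k).trans t).varGuard.Sat c.var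

/-- The `j`-th event is a discrete transition in which automaton `k` takes a transition. -/
def Moves {N : Network AP X Act V K} (η : N.Run) (j : ℕ) (k : Fin K) : Prop :=
  ∃ Λ, η.ev j = .disc Λ ∧ Λ k ≠ none

/-- The `j`-th event is a delay, and it leads to a configuration in which some transition of
automaton `k` is enabled. -/
def Ready {N : Network AP X Act V K} (η : N.Run) (j : ℕ) (k : Fin K) : Prop :=
  η.IsDelay j ∧ ∃ t, N.Enabled k t (η.conf (j + 1))

/-- `η` satisfies a liveness condition. -/
def IsLive {N : Network AP X Act V K} (η : N.Run) : Liveness → Prop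
  | .strongTransition => ∀ h k, ∃ j, h < j ∧ Moves η j k
  | .weakTransition => ∀ h, ∃ k j, h < j ∧ Moves η j k
  | .strongGuard => ∀ h k, ∃ j, h < j ∧ Ready η j k
  | .weakGuard => ∀ h, ∃ k j, h < j ∧ Ready η j k

/-- Automaton `k` performs the action `(a, s)` in `Λ`, with either kind of edge. -/
def Performs {N : Network AP X Act V K} (Λ : N.Symbols) (k : Fin K) (a : Act) (s : Prim) : Prop :=
  ∃ b, Λ k = some (.sync a s, b)

/-- Automata `k` and `k'` both take a transition in `Λ`, with the same kind of edge. -/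
def SameEdge {N : Network AP X Act V K} (Λ : N.Symbols) (k k' : Fin K) : Prop :=
  ∃ α α' b, Λ k = some (α, b) ∧ Λ k' = some (α', b)

/-- The discrete transition with symbols `Λ` taken in configuration `c` respects a
synchronization mechanism. -/
def Synchronizes {N : Network AP X Act V K} (c : N.Config) (Λ : N.Symbols) : SyncKind → Prop
  | .channel => ∀ k a,
      (Performs Λ k a .send →
        (∃! k', k' ≠ k ∧ Performs Λ k' a .recv) ∧
        ∀ k', k' ≠ k → Performs Λ k' a .recv → SameEdge Λ k k') ∧
      (Performs Λ k a .recv →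
        (∃! k', k' ≠ k ∧ Performs Λ k' a .send) ∧
        ∀ k', k' ≠ k → Performs Λ k' a .send → SameEdge Λ k k')
  | .broadcast => ∀ k a,
      (Performs Λ k a .bcastSend → ∀ k', k' ≠ k →
        ¬ Performs Λ k' a .bcastSend ∧
        ((Performs Λ k' a .bcastRecv ∧ SameEdge Λ k k') ∨
          ∀ t, ((N.aut k').trans t).action = .sync a .bcastRecv → ¬ N.Enabled k' t c)) ∧
      (Performs Λ k a .bcastRecv → ∃ k', k' ≠ k ∧ Performs Λ k' a .bcastSend)
  | .oneToMany => ∀ k a,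
      (Performs Λ k a .manySend →
        (∀ k', k' ≠ k → ¬ Performs Λ k' a .manySend) ∧
        ∃ k', k' ≠ k ∧ Performs Λ k' a .manyRecv) ∧
      (Performs Λ k a .manyRecv → ∃ k', k' ≠ k ∧ Performs Λ k' a .manySend)

/-- `η` satisfies a synchronization mechanism. -/
def IsSync {N : Network AP X Act V K} (η : N.Run) (s : SyncKind) : Prop :=
  ∀ i Λ, η.ev i = .disc Λ → Synchronizes (η.conf i) Λ s

/-- `η` satisfies a restriction on edges. -/
def RespectsEdge {N : Network AP X Act V K} (η : N.Run) : EdgeRestriction → Prop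
  | .closedOpen => ∀ i Λ, η.ev i = .disc Λ → ∀ k α b, Λ k = some (α, b) → b = .ie
  | .openClosed => ∀ i Λ, η.ev i = .disc Λ → ∀ k α b, Λ k = some (α, b) → b = .ei
  | .unrestricted => True

/-! ## The vocabulary of the encoding -/

/-- Atomic propositions of the encoding: those of the network, and `edge^{](}[k]`, which is true
when the change of automaton `k` is closed-open. -/
inductive PropSym (AP : Type*) (K : ℕ) where
  | ap (p : AP)
  | edge (k : Fin K)

/-- Integer variables of the encoding: those of the network, the location `l[k]`, the transition
`t[k]`, and the index `x_v` of the active copy of the clock `x`. -/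
inductive VarSym (X V : Type*) (K : ℕ) where
  | int (n : V)
  | loc (k : Fin K)
  | trn (k : Fin K)
  | act (x : X)

/-- Clocks of the encoding: the copies `x₀` and `x₁` of each clock `x`. -/
abbrev ClockSym (X : Type*) := X × Fin 2

abbrev Form (_N : Network AP X Act V K) := Formula (PropSym AP K) (ClockSym X) (VarSym X V K)

/-- The code of `♮`: no transition is performed. -/
def natural : ℤ := -1

/-- The domains of the variables of the encoding. -/
def symDom (N : Network AP X Act V K) : VarSym X V K → Set ℤ
  | .int n => N.dom n
  | .loc k => {z | 0 ≤ z ∧ z < (N.aut k).nLoc}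
  | .trn k => {z | z = natural ∨ (0 ≤ z ∧ z < (N.aut k).nTrans)}
  | .act _ => {0, 1}

abbrev Model (N : Network AP X Act V K) :=
  Interp (PropSym AP K) (ClockSym X) (VarSym X V K) N.symDom

/-! ## The formula `φ_N` -/

section Encoding

variable (N : Network AP X Act V K)

/-- `w = c` -/
def eqC (w : VarSym X V K) (c : ℤ) : N.Form := .cmp (.var w) .eq (.const c)

/-- `l[k] = q` -/
def atLoc (k : Fin K) (q : Fin (N.aut k).nLoc) : N.Form := N.eqC (.loc k) (q : ℕ)

/-- `t[k] = t` -/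
def takes (k : Fin K) (t : Fin (N.aut k).nTrans) : N.Form := N.eqC (.trn k) (t : ℕ)

/-- `t[k] = ♮` -/
def takesNone (k : Fin K) : N.Form := N.eqC (.trn k) natural

/-- `x_j ∼ d` for `∼` one of `<`, `=`, `>` -/
def copyCmp (x : X) (j : Fin 2) : ClockRel → ℕ → N.Form
  | .lt, d => .clk (x, j) .lt d
  | .eq, d => .clk (x, j) .eq d
  | .gt, d => .and (.not (.clk (x, j) .lt d)) (.not (.clk (x, j) .eq d))

/-- `φ_{x ∼ d}`: the active copy of `x` satisfies `∼ d`. -/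
def phiCmp (x : X) (r : ClockRel) (d : ℕ) : N.Form :=
  .or (.and (N.copyCmp x 0 r d) (N.eqC (.act x) 0)) (.and (N.copyCmp x 1 r d) (N.eqC (.act x) 1))

/-- Translation of a literal. -/
def phiLit (b : ClockLit X) : N.Form :=
  match b.pos with
  | true => N.phiCmp b.clock b.rel b.bound
  | false => .not (N.phiCmp b.clock b.rel b.bound)

/-- Translation of the weak version of a literal: `<` and `>` become `≤` and `≥`, an equality
becomes false, a negated equality true, and the other negated literals are unchanged. -/
def phiLitWeak (b : ClockLit X) : N.Form :=
  match b.pos, b.rel with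
  | true, .lt => .or (N.phiCmp b.clock .lt b.bound) (N.phiCmp b.clock .eq b.bound)
  | true, .gt => .or (N.phiCmp b.clock .gt b.bound) (N.phiCmp b.clock .eq b.bound)
  | true, .eq => .bot
  | false, .lt => .not (N.phiCmp b.clock .lt b.bound)
  | false, .gt => .not (N.phiCmp b.clock .gt b.bound)
  | false, .eq => .top

/-- Conjunction of the translations of the literals of a constraint. -/
def conjLits (f : ClockLit X → N.Form) (γ : ClockConstraint X) : N.Form :=
  (γ.map f).foldr .and .top

/-- `x₀ = 0 ∨ x₁ = 0` -/
def isReset (x : X) : N.Form := .or (N.copyCmp x 0 .eq 0) (N.copyCmp x 1 .eq 0)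

/-- `x₀ > 0 ∧ x₁ > 0` -/
def notReset (x : X) : N.Form := .and (N.copyCmp x 0 .gt 0) (N.copyCmp x 1 .gt 0)

/-- `φ_γ`, also used for `Inv(q)` -/
def phi (γ : ClockConstraint X) : N.Form := N.conjLits N.phiLit γ

/-- `Inv_w(q)` for the invariant `γ` of `q` -/
def phiWeak (γ : ClockConstraint X) : N.Form := N.conjLits N.phiLitWeak γ

/-- `r₁(γ)` -/
noncomputable def r₁ (γ : ClockConstraint X) : N.Form :=
  N.conjLits (fun b => .imp (N.isReset b.clock) (.truth (b.holdsAt 0))) γ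

/-- `r₂(γ)` -/
noncomputable def r₂ (γ : ClockConstraint X) : N.Form :=
  N.conjLits (fun b => .and (.imp (N.notReset b.clock) (N.phiLit b))
    (.imp (N.isReset b.clock) (.truth (b.holdsAt 0)))) γ

/-- `r₂` of the weak version of `γ` -/
noncomputable def r₂Weak (γ : ClockConstraint X) : N.Form :=
  N.conjLits (fun b => .and (.imp (N.notReset b.clock) (N.phiLitWeak b))
    (.imp (N.isReset b.clock) (.truth (b.weakAt 0)))) γ

/-- `φ_ξ` -/
def phiVar : VarConstraint V → N.Form
  | .tt => .top
  | .cmpConst n r c => .cmp (.var (.int n)) r (.const c)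
  | .cmpVar n r n' => .cmp (.var (.int n)) r (.var (.int n'))
  | .not ξ => .not (phiVar ξ)
  | .and ξ ξ' => .and (phiVar ξ) (phiVar ξ')

/-- `φ_μ`, evaluated in the position before the assignments take effect -/
def phiAssign (μ : List (V × Expr V)) : N.Form :=
  (μ.map fun a => Formula.nextCmp (.int a.1) .eq (a.2.map .int)).foldr .and .top

/-- `φ_ζ` -/
noncomputable def phiReset (ζ : Finset X) : N.Form := .all ζ N.isReset

/-- `φ_edge(a, b, k)` -/
noncomputable def phiEdge (k : Fin K) (a b : Fin (N.aut k).nLoc) : N.Form :=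
  .or
    (.and (N.phi ((N.aut k).inv a)) (.and (N.r₂Weak ((N.aut k).inv b)) (.prop (.edge k))))
    (.and (N.phiWeak ((N.aut k).inv a)) (.and (N.r₂ ((N.aut k).inv b)) (.not (.prop (.edge k)))))

variable [Fintype X] [Fintype V]

/-- The formula constraining the two copies of each clock. -/
noncomputable def phiClock : N.Form :=
  let φ₁ : N.Form := .all Finset.univ fun x : X =>
    .and (N.copyCmp x 0 .eq 0) (.and (N.copyCmp x 1 .gt 0) (N.eqC (.act x) 0))
  let φ₂ : Fin 2 → N.Form := fun j => .all Finset.univ fun x : X =>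
    .imp (N.copyCmp x j .eq 0)
      (.next (.release (N.copyCmp x (j + 1) .eq 0)
        (.and (N.eqC (.act x) (j : ℕ)) (N.copyCmp x j .gt 0))))
  .and φ₁ (.globally (.and (φ₂ 0) (φ₂ 1)))

/-- Initially every automaton is in location `0`. -/
noncomputable def varphi₁ : N.Form := .all Finset.univ fun k => N.eqC (.loc k) 0

/-- Initial values of the variables. -/
noncomputable def varphi₂ : N.Form := .all Finset.univ fun n => N.eqC (.int n) (N.var₀ n)

/-- The invariants hold initially. -/
noncomputable def varphi₃ : N.Form :=
  .all Finset.univ fun k => .all Finset.univ fun q =>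
    .imp (N.atLoc k q) (N.phi ((N.aut k).inv q))

/-- Automata that take no transition keep satisfying their invariants. -/
noncomputable def varphi₄ : N.Form :=
  .all Finset.univ fun k => .all Finset.univ fun q =>
    .imp (.and (N.atLoc k q) (N.takesNone k))
      (.next (.and (N.phi ((N.aut k).inv q)) (N.r₁ ((N.aut k).inv q))))

/-- Necessary conditions of transitions. -/
noncomputable def varphi₅ : N.Form :=
  .all Finset.univ fun k => .all Finset.univ fun t =>
    let τ := (N.aut k).trans t
    .imp (N.takes k t)
      (.and (N.atLoc k τ.src) (.and (N.phiVar τ.varGuard) (.and (N.phiAssign τ.assigns)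
        (.next (.and (N.atLoc k τ.tgt) (.and (N.phi τ.guard)
          (.and (N.phiReset τ.resets) (N.phiEdge k τ.src τ.tgt))))))))

open Classical in
/-- Changes of location are caused by transitions. -/
noncomputable def varphi₆ : N.Form :=
  .all Finset.univ fun k => .all {p : Fin (N.aut k).nLoc × Fin (N.aut k).nLoc | p.1 ≠ p.2} fun p =>
    .imp (.and (N.atLoc k p.1) (.next (N.atLoc k p.2)))
      (.any {t : Fin (N.aut k).nTrans |
        ((N.aut k).trans t).src = p.1 ∧ ((N.aut k).trans t).tgt = p.2} fun t => N.takes k t)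

open Classical in
/-- Resets of clocks are caused by transitions. -/
noncomputable def varphi₇ : N.Form :=
  .all Finset.univ fun x : X => .imp (.next (N.isReset x))
    (.any Finset.univ fun k => .any {t : Fin (N.aut k).nTrans |
      x ∈ ((N.aut k).trans t).resets} fun t => N.takes k t)

open Classical in
/-- Changes of variables are caused by transitions. -/
noncomputable def varphi₈ : N.Form :=
  .all Finset.univ fun n : V => .imp (.not (.nextCmp (.int n) .eq (.var (.int n))))
    (.any Finset.univ fun k => .any {t : Fin (N.aut k).nTrans |
      n ∈ ((N.aut k).trans t).updated} fun t => N.takes k t)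

/-- `φ_N` -/
noncomputable def varphiNet : N.Form :=
  .and N.phiClock (.and N.varphi₁ (.and N.varphi₂ (.and N.varphi₃
    (.globally (.and N.varphi₄ (.and N.varphi₅ (.and N.varphi₆ (.and N.varphi₇ N.varphi₈))))))))


/-! ## The formulae `φ_l`, `φ_s`, `φ_ef` and `Φ_N` -/

/-- Transition `t` of automaton `k` is enabled at the next change: its variable guard is evaluated
in the present position, its clock guard in the next one (as in `varphi₅`). -/
def phiEnabled (k : Fin K) (t : Fin (N.aut k).nTrans) : N.Form :=
  .and (N.atLoc k ((N.aut k).trans t).src) (.and (N.phiVar ((N.aut k).trans t).varGuard)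
    (.next (N.phi ((N.aut k).trans t).guard)))

/-- Encoding of a liveness condition. -/
noncomputable def phiLive : Liveness → N.Form
  | .strongTransition => .all Finset.univ fun k =>
      .globally (.eventually (.any Finset.univ fun t => N.takes k t))
  | .weakTransition =>
      .globally (.eventually (.any Finset.univ fun k => .any Finset.univ fun t => N.takes k t))
  | .strongGuard => .globally (.all Finset.univ fun k =>
      .eventually (.any Finset.univ fun t => N.phiEnabled k t))
  | .weakGuard => .globally (.any Finset.univ fun k =>
      .eventually (.any Finset.univ fun t => N.phiEnabled k t))

open Classical in
/-- Automaton `k` fires a transition labelled with `α`. -/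
noncomputable def syncOn (k : Fin K) (α : Action Act) : N.Form :=
  .any {t : Fin (N.aut k).nTrans | ((N.aut k).trans t).action = α} fun t => N.takes k t

/-- Some automaton with index outside `S` fires a transition labelled with `α`. -/
noncomputable def syncOnBut (S : Finset (Fin K)) (α : Action Act) : N.Form :=
  .any (Finset.univ \ S) fun g => N.syncOn g α

/-- The next changes of automata `k` and `h` have the same kind of edge. -/
def sameEdge (k h : Fin K) : N.Form := .next (.iff (.prop (.edge k)) (.prop (.edge h)))

open Classical in
/-- `⋀` over all automata `k`, all events `a` and all transitions `t` of `k` labelled with `(a, s)`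
of the formula `t[k] = t → f k a`. -/
noncomputable def whenever (s : Prim) (f : Fin K → Act → N.Form) : N.Form :=
  .all Finset.univ fun k => .all Finset.univ fun t =>
    match ((N.aut k).trans t).action with
    | .tau => .top
    | .sync a s' => if s' = s then .imp (N.takes k t) (f k a) else .top

open Classical in
/-- Encoding of a synchronization mechanism. -/
noncomputable def phiSync : SyncKind → N.Form
  | .channel => .globally (.and
      (N.whenever .send fun k a => .any (Finset.univ \ {k}) fun h =>
        .and (N.syncOn h (.sync a .recv))
          (.and (.not (N.syncOnBut {k, h} (.sync a .recv))) (N.sameEdge k h)))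
      (N.whenever .recv fun k a => .any (Finset.univ \ {k}) fun h =>
        .and (N.syncOn h (.sync a .send)) (.not (N.syncOnBut {k, h} (.sync a .send)))))
  | .broadcast => .globally (.and
      (.and
        (N.whenever .bcastSend fun k a => .not (N.syncOnBut {k} (.sync a .bcastSend)))
        (N.whenever .bcastSend fun k a => .all (Finset.univ \ {k}) fun h =>
          .or (.and (N.syncOn h (.sync a .bcastRecv)) (N.sameEdge k h))
            (.all {t : Fin (N.aut h).nTrans |
                ((N.aut h).trans t).action = .sync a .bcastRecv} fun t =>
              .or (.next (.not (N.phi ((N.aut h).trans t).guard)))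
                (.or (.not (N.phiVar ((N.aut h).trans t).varGuard))
                  (.not (N.atLoc h ((N.aut h).trans t).src))))))
      (N.whenever .bcastRecv fun k a => N.syncOnBut {k} (.sync a .bcastSend)))
  | .oneToMany => .globally (.and
      (N.whenever .manySend fun k a =>
        .and (.not (N.syncOnBut {k} (.sync a .manySend))) (N.syncOnBut {k} (.sync a .manyRecv)))
      (N.whenever .manyRecv fun k a => N.syncOnBut {k} (.sync a .manySend)))

/-- Encoding of a restriction on edges: every transition that is taken has the required edge. -/
noncomputable def phiEF : EdgeRestriction → N.Form
  | .closedOpen => .globally (.all Finset.univ fun k =>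
      .imp (.not (N.takesNone k)) (.next (.prop (.edge k))))
  | .openClosed => .globally (.all Finset.univ fun k =>
      .imp (.not (N.takesNone k)) (.next (.not (.prop (.edge k)))))
  | .unrestricted => .top

/-- `Φ_N = φ_N ∧ φ_l ∧ φ_s ∧ φ_ef` -/
noncomputable def Phi (l : Finset Liveness) (s : Finset SyncKind) (ef : Finset EdgeRestriction) :
    N.Form :=
  .and N.varphiNet (.and (.all l N.phiLive) (.and (.all s N.phiSync) (.all ef N.phiEF)))

end Encoding

/-! ## The mapping `ρ` from traces to models -/

/-- Sequences `c₀ →^{δ₀} c'₀ →^{Λ₀} c₁ →^{δ₁} c'₁ →^{Λ₁} …` in which delays and discrete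
transitions alternate. -/
structure AltRun (N : Network AP X Act V K) where
  conf : ℕ → N.Config
  delay : ℕ → ℝ
  conf' : ℕ → N.Config
  symb : ℕ → N.Symbols

/-- An alternating sequence as a sequence of configurations and events. -/
def AltRun.toRun {N : Network AP X Act V K} (a : N.AltRun) : N.Run where
  conf i := if i % 2 = 0 then a.conf (i / 2) else a.conf' (i / 2)
  ev i := if i % 2 = 0 then .delay (a.delay (i / 2)) else .disc (a.symb (i / 2))

/-- `a` is the alternating form of `η`: it is obtained from `η` by inserting, between any two
consecutive delays, a discrete transition in which nothing happens. Event `i` of `η` becomes event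
`f i` of `a`. -/
def IsAltForm {N : Network AP X Act V K} (η : N.Run) (a : N.AltRun) : Prop :=
  ∃ f : ℕ → ℕ, f 0 = 0 ∧
    (∀ i, a.toRun.conf (f i) = η.conf i ∧ a.toRun.ev (f i) = η.ev i) ∧
    (∀ i, η.IsDelay i ∧ η.IsDelay (i + 1) →
      f (i + 1) = f i + 2 ∧ a.toRun.conf (f i + 1) = η.conf (i + 1) ∧
        a.toRun.ev (f i + 1) = .disc fun _ => none) ∧
    (∀ i, ¬ (η.IsDelay i ∧ η.IsDelay (i + 1)) → f (i + 1) = f i + 1)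

/-- The copy of `x` that is active in position `i`. -/
def active {N : Network AP X Act V K} (m : N.Model) (x : X) (i : ℕ) : Fin 2 :=
  if m.val i (.act x) = 0 then 0 else 1

/-- The integer code of an optional transition. -/
def code {n : ℕ} : Option (Fin n) → ℤ
  | none => natural
  | some t => (t : ℕ)

/-- `m` is one of the models associated with the alternating trace `a`. Clock `x` is reset in
position `h + 1` exactly if `v_{h+1}(x) = 0`, because delays are positive. -/
structure Represents {N : Network AP X Act V K} (a : N.AltRun) (m : N.Model) : Prop where
  loc : ∀ h k, m.val h (.loc k) = ((a.conf h).loc k : ℕ)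
  var : ∀ h n, m.val h (.int n) = (a.conf h).var n
  label : ∀ h p, .ap p ∈ m.prop h ↔ ∃ k, p ∈ (N.aut k).label ((a.conf h).loc k)
  clk_zero : ∀ x, m.clk 0 (x, 0) = 0 ∧ 0 < m.clk 0 (x, 1)
  act_zero : ∀ x, m.val 0 (.act x) = 0 ∧ m.val 1 (.act x) = 0
  clk_active : ∀ h x,
    (m.clk (h + 1) (x, active m x (h + 1)) : ℝ) = m.clk h (x, active m x (h + 1)) + a.delay h
  clk_inactive : ∀ h x, (a.conf (h + 1)).clk x ≠ 0 →
    (m.clk (h + 1) (x, active m x (h + 1) + 1) : ℝ) =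
      m.clk h (x, active m x (h + 1) + 1) + a.delay h
  clk_reset : ∀ h x, (a.conf (h + 1)).clk x = 0 →
    m.clk (h + 1) (x, active m x (h + 1) + 1) = 0
  act_keep : ∀ h x, (a.conf (h + 1)).clk x ≠ 0 →
    m.val (h + 2) (.act x) = m.val (h + 1) (.act x)
  act_switch : ∀ h x, (a.conf (h + 1)).clk x = 0 →
    m.val (h + 2) (.act x) = (m.val (h + 1) (.act x) + 1) % 2
  trn : ∀ h, ∃ ts, N.DiscreteStepVia ts (a.conf' h) (a.symb h) (a.conf (h + 1)) ∧
    ∀ k, m.val h (.trn k) = code (ts k)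
  edge : ∀ h k α b, a.symb h k = some (α, b) → (.edge k ∈ m.prop (h + 1) ↔ b = .ie)

/-- `ρ(η)`. -/
def rho {N : Network AP X Act V K} (η : N.Run) : Set N.Model :=
  {m | ∃ a, IsAltForm η a ∧ Represents a m}

/-! ## The mapping `ρ⁻¹` from models to traces -/

/-- The transition with a given code, if there is one. -/
def decode (n : ℕ) (z : ℤ) : Option (Fin n) :=
  if h : 0 ≤ z ∧ z < n then some ⟨z.toNat, by omega⟩ else none

/-- The location of automaton `k` in position `h` of a model. -/
def modelLoc {N : Network AP X Act V K} (m : N.Model) (h : ℕ) (k : Fin K) :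
    Fin (N.aut k).nLoc :=
  ⟨(m.val h (.loc k)).toNat, by
    have hz : 0 ≤ m.val h (.loc k) ∧ m.val h (.loc k) < (N.aut k).nLoc := m.mem_dom h (.loc k)
    omega⟩

open Classical in
/-- The alternating sequence of a model. The configuration `c_h` has the clock values after the
resets in position `h`, the configuration `c'_h` has the values of the active clocks in position
`h + 1`, and `δ_h` is the increase of the clock copies that are not reset in position `h + 1`. -/
noncomputable def altOfModel [Nonempty X] {N : Network AP X Act V K} (m : N.Model) : N.AltRun where
  conf h :=
    { loc := modelLoc m h
      var := fun n => m.val h (.int n)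
      clk := fun x =>
        if m.clk h (x, 0) = 0 ∨ m.clk h (x, 1) = 0 then 0 else m.clk h (x, active m x h) }
  delay h :=
    let x : X := Classical.arbitrary X
    (m.clk (h + 1) (x, active m x (h + 1)) : ℝ) - m.clk h (x, active m x (h + 1))
  conf' h :=
    { loc := modelLoc m h
      var := fun n => m.val h (.int n)
      clk := fun x => m.clk (h + 1) (x, active m x (h + 1)) }
  symb h k := (decode (N.aut k).nTrans (m.val h (.trn k))).map fun t =>
    (((N.aut k).trans t).action, if .edge k ∈ m.prop (h + 1) then .ie else .ei)

/-- `ρ⁻¹((π, σ, ι))`. -/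
noncomputable def rhoInv [Nonempty X] {N : Network AP X Act V K} (m : N.Model) : N.Run :=
  (altOfModel m).toRun

end Network

end TimedNet

/-!
The alternating sequence `altOfModel m` is defined for every model `m`, and all formulae are about
this sequence. Its configurations consist of the values of the active clock copies before the resets
of a position (`activeVal`) and of the values after the resets (`settledVal`): `φ_γ` is evaluated on
the former, while `r₂(γ)`, and `φ_γ` together with `r₁(γ)`, speak about the latter. Hence each of
`φ_l`, `φ_s`, `φ_ef` holds in `m` if and only if `ρ⁻¹(m)` satisfies the corresponding conditions
(`isModel_Phi_iff`), and `φ_N` holds if and only if the two copies of each clock take turns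
(`CopyDiscipline`), the initial conditions hold, and all changes of position are discrete transitions
(`sat_varphiNet`).

From models to traces, it remains to find the time transitions. An active copy is positive, so it
was not reset in the last step; thus all clocks progress by the common delay of the clock
assignment. The invariants hold, strongly or weakly, before and after the delay, because they do so
in the adjacent discrete transitions, and then they hold weakly after the delay
(`ClockConstraint.weakSat_of_delay`).

From traces to models, the conditions pass from a trace `η` to its alternating form `a`, since the
inserted events are empty (`IsAltForm.exists_altIndex`). A model `m` representing `a` respects the
discipline of the copies, and `a` is recovered from it: `a = altOfModel m`
(`Represents.eq_altOfModel`). So the equivalences above apply again.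
-/

namespace TimedNet

/-! ### Satisfaction of derived connectives -/

namespace Interp

variable {P C W : Type*} {dom : W → Set ℤ} (m : Interp P C W dom) (φ ψ : Formula P C W) (i : ℕ)

@[simp] theorem sat_and : m.sat (.and φ ψ) i ↔ m.sat φ i ∧ m.sat ψ i := Iff.rfl

@[simp] theorem sat_not : m.sat (.not φ) i ↔ ¬ m.sat φ i := Iff.rfl

@[simp] theorem sat_next : m.sat (.next φ) i ↔ m.sat φ (i + 1) := Iff.rfl

@[simp] theorem sat_prop (p : P) : m.sat (.prop p) i ↔ p ∈ m.prop i := Iff.rfl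

@[simp] theorem sat_top : m.sat .top i := rfl

@[simp] theorem not_sat_bot : ¬ m.sat .bot i := fun h => h rfl

@[simp] theorem sat_or : m.sat (.or φ ψ) i ↔ m.sat φ i ∨ m.sat ψ i := by
  simp only [Formula.or, sat_not, sat_and]; tauto

@[simp] theorem sat_imp : m.sat (.imp φ ψ) i ↔ (m.sat φ i → m.sat ψ i) := by
  simp only [Formula.imp, sat_not, sat_or]; tauto

@[simp] theorem sat_iff : m.sat (.iff φ ψ) i ↔ (m.sat φ i ↔ m.sat ψ i) := by
  simp only [Formula.iff, sat_imp, sat_and]; tauto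

@[simp] theorem sat_eventually : m.sat (.eventually φ) i ↔ ∃ j, i ≤ j ∧ m.sat φ j := by
  simp [Formula.eventually, sat]

@[simp] theorem sat_globally : m.sat (.globally φ) i ↔ ∀ j, i ≤ j → m.sat φ j := by
  simp [Formula.globally]

@[simp] theorem sat_release : m.sat (.release φ ψ) i ↔
    ∀ j, i ≤ j → (∀ h, i ≤ h → h < j → ¬ m.sat φ h) → m.sat ψ j := by
  simp only [Formula.release, sat, not_exists, not_and]
  exact forall₂_congr fun j _ => ⟨fun h hφ => by_contra fun hψ => h hψ hφ, fun h hψ hφ => hψ (h hφ)⟩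

@[simp] theorem sat_truth (p : Prop) : m.sat (.truth p) i ↔ p := by
  unfold Formula.truth; split_ifs with h <;> simp [h]

theorem sat_foldr_and (L : List (Formula P C W)) :
    m.sat (L.foldr .and .top) i ↔ ∀ φ ∈ L, m.sat φ i := by
  induction L with
  | nil => simp
  | cons φ L ih => simp [ih]

@[simp] theorem sat_all {α : Type*} (s : Finset α) (f : α → Formula P C W) :
    m.sat (.all s f) i ↔ ∀ x ∈ s, m.sat (f x) i := by
  simp [Formula.all, sat_foldr_and]

@[simp] theorem sat_any {α : Type*} (s : Finset α) (f : α → Formula P C W) :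
    m.sat (.any s f) i ↔ ∃ x ∈ s, m.sat (f x) i := by
  have key : ∀ L : List (Formula P C W), m.sat (L.foldr .or .bot) i ↔ ∃ φ ∈ L, m.sat φ i := by
    intro L
    induction L with
    | nil => simp
    | cons φ L ih => simp [ih]
  simp [Formula.any, key]

end Interp

theorem Expr.eval_map {W W' : Type*} (f : W → W') (v : W' → ℤ) (e : Expr W) :
    (e.map f).eval v = e.eval (v ∘ f) := by
  induction e <;> simp_all [Expr.map, Expr.eval]

/-- Except for positive equations, a literal implies its weak version. -/
theorem ClockLit.weakAt_of_holdsAt {X : Type*} {b : ClockLit X} {r : ℝ≥0} (h : b.holdsAt r)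
    (hb : ¬ (b.pos = true ∧ b.rel = .eq)) : b.weakAt r := by
  obtain ⟨x, rel, d, pos⟩ := b
  cases pos <;> cases rel <;> simp_all [holdsAt, weakAt, ClockRel.holds]

/-- A constraint that holds, strongly or weakly, at the start and at the end of a delay holds weakly
at the end. Strong satisfaction at the end does not suffice: it does not imply weak satisfaction in
the presence of equations `x = d`, but no such equation survives a positive delay. -/
theorem ClockConstraint.weakSat_of_delay {X : Type*} {γ : ClockConstraint X} {v v' : X → ℝ≥0}
    (hlt : ∀ x, v x < v' x) (h : γ.Sat v ∨ γ.WeakSat v) (h' : γ.Sat v' ∨ γ.WeakSat v') :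
    γ.WeakSat v' := by
  refine h'.elim (fun h' b hb => ?_) id
  refine ClockLit.weakAt_of_holdsAt (h' b hb) fun ⟨hp, hr⟩ => ?_
  have h₁ := h' b hb
  have h₀ := h.imp (· b hb) (· b hb)
  simp only [ClockLit.holdsAt, ClockLit.weakAt, hp, hr, ClockRel.holds, or_false] at h₀ h₁
  exact (hlt b.clock).ne (h₀.trans h₁.symm)

namespace Network

variable {AP X Act V : Type*} {K : ℕ} {N : Network AP X Act V K}

/-! ### Clock values of a model, and the atoms of the encoding -/

/-- The value of the active copy of `x` in position `i`: the value of the clock before the resets of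
this position. -/
def activeVal (m : N.Model) (i : ℕ) (x : X) : ℝ≥0 := m.clk i (x, active m x i)

/-- One of the copies of `x` is zero in position `i`. -/
def HasReset (m : N.Model) (i : ℕ) (x : X) : Prop := m.clk i (x, 0) = 0 ∨ m.clk i (x, 1) = 0

open Classical in
/-- The value of the clock `x` in position `i` after the resets of this position. -/
noncomputable def settledVal (m : N.Model) (i : ℕ) (x : X) : ℝ≥0 :=
  if HasReset m i x then 0 else activeVal m i x

theorem settledVal_of_hasReset {m : N.Model} {i : ℕ} {x : X} (h : HasReset m i x) :
    settledVal m i x = 0 := if_pos h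

theorem settledVal_of_not_hasReset {m : N.Model} {i : ℕ} {x : X} (h : ¬ HasReset m i x) :
    settledVal m i x = activeVal m i x := if_neg h

theorem val_act (m : N.Model) (i : ℕ) (x : X) : m.val i (.act x) = (active m x i : ℕ) := by
  have h : m.val i (.act x) = 0 ∨ m.val i (.act x) = 1 := m.mem_dom i (.act x)
  unfold active
  rcases h with h | h <;> simp [h]

theorem settledVal_eq_zero {m : N.Model} {i : ℕ} {x : X} :
    settledVal m i x = 0 ↔ HasReset m i x := by
  refine ⟨fun h => by_contra fun hr => hr ?_, settledVal_of_hasReset⟩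
  rw [settledVal_of_not_hasReset hr, activeVal] at h
  generalize active m x i = j at h
  fin_cases j
  exacts [.inl h, .inr h]

theorem hasReset_iff (m : N.Model) (i : ℕ) (x : X) (j : Fin 2) :
    HasReset m i x ↔ m.clk i (x, j) = 0 ∨ m.clk i (x, j + 1) = 0 := by
  fin_cases j
  · rfl
  · exact or_comm

section Sat

variable (m : N.Model) (i : ℕ)

@[simp] theorem sat_eqC (w : VarSym X V K) (c : ℤ) : m.sat (N.eqC w c) i ↔ m.val i w = c := Iff.rfl

@[simp] theorem sat_atLoc (k : Fin K) (q : Fin (N.aut k).nLoc) :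
    m.sat (N.atLoc k q) i ↔ modelLoc m i k = q := by
  have hz : 0 ≤ m.val i (.loc k) ∧ _ := m.mem_dom i (.loc k)
  simp only [atLoc, sat_eqC, modelLoc, Fin.ext_iff]
  omega

@[simp] theorem sat_copyCmp (x : X) (j : Fin 2) (r : ClockRel) (d : ℕ) :
    m.sat (N.copyCmp x j r d) i ↔ r.holds (m.clk i (x, j)) d := by
  cases r <;> simp only [copyCmp, Interp.sat, CRel.holds, ClockRel.holds]
  rw [not_lt, and_comm, eq_comm, lt_iff_le_and_ne, and_comm]

@[simp] theorem sat_phiCmp (x : X) (r : ClockRel) (d : ℕ) :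
    m.sat (N.phiCmp x r d) i ↔ r.holds (activeVal m i x) d := by
  simp only [phiCmp, Interp.sat_or, Interp.sat_and, sat_copyCmp, sat_eqC, val_act, activeVal]
  obtain h | h : active m x i = 0 ∨ active m x i = 1 := by
    generalize active m x i = j; fin_cases j <;> simp
  all_goals simp [h]

@[simp] theorem sat_phiLit (b : ClockLit X) :
    m.sat (N.phiLit b) i ↔ b.holdsAt (activeVal m i b.clock) := by
  obtain ⟨x, r, d, p⟩ := b
  cases p <;> simp [phiLit, ClockLit.holdsAt]

@[simp] theorem sat_phiLitWeak (b : ClockLit X) :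
    m.sat (N.phiLitWeak b) i ↔ b.weakAt (activeVal m i b.clock) := by
  obtain ⟨x, r, d, p⟩ := b
  cases p <;> cases r <;> simp [phiLitWeak, ClockLit.weakAt, ClockRel.holds]

theorem sat_conjLits (f : ClockLit X → N.Form) (γ : ClockConstraint X) :
    m.sat (N.conjLits f γ) i ↔ ∀ b ∈ γ, m.sat (f b) i := by
  simp [conjLits, Interp.sat_foldr_and]

@[simp] theorem sat_phi (γ : ClockConstraint X) :
    m.sat (N.phi γ) i ↔ γ.Sat (activeVal m i) := by
  simp [phi, sat_conjLits, ClockConstraint.Sat]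

@[simp] theorem sat_phiWeak (γ : ClockConstraint X) :
    m.sat (N.phiWeak γ) i ↔ γ.WeakSat (activeVal m i) := by
  simp [phiWeak, sat_conjLits, ClockConstraint.WeakSat]

@[simp] theorem sat_isReset (x : X) : m.sat (N.isReset x) i ↔ HasReset m i x := by
  simp [isReset, HasReset, ClockRel.holds]

@[simp] theorem sat_notReset (x : X) : m.sat (N.notReset x) i ↔ ¬ HasReset m i x := by
  simp [notReset, HasReset, ClockRel.holds, pos_iff_ne_zero]

theorem sat_r₁ (γ : ClockConstraint X) :
    m.sat (N.r₁ γ) i ↔ ∀ b ∈ γ, HasReset m i b.clock → b.holdsAt 0 := by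
  simp [r₁, sat_conjLits]

/-- Together, `φ_γ` and `r₁(γ)` say that `γ` holds before and after the resets. -/
theorem sat_phi_and_r₁ (γ : ClockConstraint X) :
    γ.Sat (activeVal m i) ∧ m.sat (N.r₁ γ) i ↔
      γ.Sat (activeVal m i) ∧ γ.Sat (settledVal m i) := by
  rw [sat_r₁]
  refine and_congr_right fun h => forall₂_congr fun b hb => ?_
  by_cases hr : HasReset m i b.clock
  · simp [hr, settledVal_of_hasReset]
  · simp [hr, settledVal_of_not_hasReset, h b hb]

@[simp] theorem sat_r₂ (γ : ClockConstraint X) :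
    m.sat (N.r₂ γ) i ↔ γ.Sat (settledVal m i) := by
  rw [r₂, sat_conjLits]
  refine forall₂_congr fun b _ => ?_
  by_cases hr : HasReset m i b.clock
  · simp [hr, settledVal_of_hasReset]
  · simp [hr, settledVal_of_not_hasReset]

@[simp] theorem sat_r₂Weak (γ : ClockConstraint X) :
    m.sat (N.r₂Weak γ) i ↔ γ.WeakSat (settledVal m i) := by
  rw [r₂Weak, sat_conjLits]
  refine forall₂_congr fun b _ => ?_
  by_cases hr : HasReset m i b.clock
  · simp [hr, settledVal_of_hasReset]
  · simp [hr, settledVal_of_not_hasReset]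

@[simp] theorem sat_phiVar (ξ : VarConstraint V) :
    m.sat (N.phiVar ξ) i ↔ ξ.Sat fun n => m.val i (.int n) := by
  induction ξ with
  | tt => simp [phiVar, VarConstraint.Sat]
  | cmpConst n r c => rfl
  | cmpVar n r n' => rfl
  | not ξ ih => simp [phiVar, VarConstraint.Sat, ih]
  | and ξ ξ' ih ih' => simp [phiVar, VarConstraint.Sat, ih, ih']

@[simp] theorem sat_phiAssign (μ : List (V × Expr V)) :
    m.sat (N.phiAssign μ) i ↔
      ∀ a ∈ μ, m.val (i + 1) (.int a.1) = a.2.eval fun n => m.val i (.int n) := by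
  simp only [phiAssign, Interp.sat_foldr_and, List.forall_mem_map, Interp.sat, CRel.holds,
    Expr.eval_map, Function.comp_def]

@[simp] theorem sat_phiReset (ζ : Finset X) :
    m.sat (N.phiReset ζ) i ↔ ∀ x ∈ ζ, HasReset m i x := by
  simp [phiReset]

end Sat

theorem code_injective {n : ℕ} : Function.Injective (code : Option (Fin n) → ℤ) := by
  rintro (_ | s) (_ | t) h
  · rfl
  · simp only [code, natural] at h; omega
  · simp only [code, natural] at h; omega
  · simp only [code, Nat.cast_inj] at h; rw [Fin.ext h]

theorem code_decode {n : ℕ} {z : ℤ} (hz : z = natural ∨ (0 ≤ z ∧ z < n)) :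
    code (decode n z) = z := by
  unfold decode
  split_ifs with h
  · exact Int.toNat_of_nonneg h.1
  · exact (hz.resolve_right h).symm

/-! ### The discipline of the clock copies -/

/-- What `φ_clock` says about a model: copy `0` is the zero and active one initially, active copies
are positive in all later positions, and the active copy changes from one position to the next
exactly if the other copy is zero. -/
structure CopyDiscipline (m : N.Model) : Prop where
  clk_zero : ∀ x, m.clk 0 (x, 0) = 0 ∧ 0 < m.clk 0 (x, 1)
  active_zero : ∀ x, active m x 0 = 0
  active_one : ∀ x, active m x 1 = 0
  pos : ∀ i x, 0 < activeVal m (i + 1) x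
  switch : ∀ i x, m.clk (i + 1) (x, active m x (i + 1) + 1) = 0 →
    active m x (i + 2) = active m x (i + 1) + 1
  keep : ∀ i x, m.clk (i + 1) (x, active m x (i + 1) + 1) ≠ 0 →
    active m x (i + 2) = active m x (i + 1)

/-- The release operator in `phiClock`, unfolded: after a zero of copy `j`, this copy is active and
positive up to and including the next zero of the other copy. -/
theorem sat_phiClock [Fintype X] [Fintype V] (m : N.Model) :
    m.sat N.phiClock 0 ↔
      (∀ x, m.clk 0 (x, 0) = 0 ∧ 0 < m.clk 0 (x, 1) ∧ active m x 0 = 0) ∧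
      ∀ p x j, m.clk p (x, j) = 0 → ∀ i, p + 1 ≤ i →
        (∀ h, p + 1 ≤ h → h < i → m.clk h (x, j + 1) ≠ 0) →
          active m x i = j ∧ 0 < m.clk i (x, j) := by
  have hact : ∀ i x (j : Fin 2), m.val i (.act x) = ((j : ℕ) : ℤ) ↔ active m x i = j := by
    intro i x j; rw [val_act]; simp [Fin.ext_iff]
  have h0 : ∀ x, m.val 0 (.act x) = 0 ↔ active m x 0 = 0 := fun x => hact 0 x 0
  simp only [phiClock, Interp.sat_and, Interp.sat_all, sat_copyCmp, sat_eqC, Interp.sat_globally,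
    Interp.sat_imp, Interp.sat_next, Interp.sat_release, hact, h0, ClockRel.holds, Finset.mem_univ,
    true_imp_iff, Nat.cast_zero, Nat.zero_le]
  refine and_congr Iff.rfl ⟨fun h p x j => ?_, fun h p => ⟨fun x => h p x 0, fun x => h p x 1⟩⟩
  fin_cases j
  · exact (h p).1 x
  · exact (h p).2 x

theorem CopyDiscipline.sat_phiClock [Fintype X] [Fintype V] {m : N.Model}
    (hm : CopyDiscipline m) : m.sat N.phiClock 0 := by
  refine (Network.sat_phiClock m).2
    ⟨fun x => ⟨(hm.clk_zero x).1, (hm.clk_zero x).2, hm.active_zero x⟩, fun p x j hj => ?_⟩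
  -- A copy is zero only when it is inactive, or in position `0`.
  have hnext : active m x (p + 1) = j := by
    cases p with
    | zero =>
      rw [hm.active_one]
      have := (hm.clk_zero x).2.ne'
      fin_cases j
      · rfl
      · exact absurd hj this
    | succ p =>
      have hne : active m x (p + 1) ≠ j := by
        rintro rfl; exact (hm.pos p x).ne' hj
      have hj' : j = active m x (p + 1) + 1 := by omega
      rw [hm.switch p x (hj' ▸ hj), hj']
  have hpos : ∀ i, active m x (i + 1) = j → 0 < m.clk (i + 1) (x, j) := by
    rintro i rfl; exact hm.pos i x
  intro i hi
  induction i, hi using Nat.le_induction with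
  | base => exact fun _ => ⟨hnext, hpos p hnext⟩
  | succ i hi ih =>
    intro h
    obtain ⟨i, rfl⟩ : ∃ i', i = i' + 1 := ⟨i - 1, by omega⟩
    have ha := (ih fun h' h₁ h₂ => h h' h₁ (by omega)).1
    have := hm.keep i x (by rw [ha]; exact h _ hi (by omega))
    rw [ha] at this
    exact ⟨this, hpos _ this⟩

theorem copyDiscipline_of_sat [Fintype X] [Fintype V] {m : N.Model}
    (hm : m.sat N.phiClock 0) : CopyDiscipline m := by
  rw [Network.sat_phiClock] at hm
  obtain ⟨h0, hrel⟩ := hm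
  -- The active copy was zero at some earlier position, and the other copy has not been zero since.
  have key : ∀ x i, ∃ p ≤ i, m.clk p (x, active m x (i + 1)) = 0 ∧
      (∀ h, p + 1 ≤ h → h < i + 1 → m.clk h (x, active m x (i + 1) + 1) ≠ 0) := by
    intro x i
    induction i with
    | zero =>
      have h1 := (hrel 0 x 0 (h0 x).1 1 le_rfl (by omega)).1
      exact ⟨0, le_rfl, by rw [h1]; exact (h0 x).1, by omega⟩
    | succ i ih =>
      obtain ⟨p, hp, hz, hne⟩ := ih
      by_cases hs : m.clk (i + 1) (x, active m x (i + 1) + 1) = 0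
      · have := (hrel (i + 1) x _ hs (i + 2) le_rfl (by omega)).1
        exact ⟨i + 1, le_rfl, by rw [this]; exact hs, by omega⟩
      · have hne' : ∀ h, p + 1 ≤ h → h < i + 2 → m.clk h (x, active m x (i + 1) + 1) ≠ 0 := by
          intro h h₁ h₂
          obtain h₂ | rfl : h < i + 1 ∨ h = i + 1 := by omega
          · exact hne h h₁ h₂
          · exact hs
        have := (hrel p x _ hz (i + 2) (by omega) hne').1
        exact ⟨p, by omega, by rw [this]; exact hz, by rw [this]; exact hne'⟩
  refine ⟨fun x => ⟨(h0 x).1, (h0 x).2.1⟩, fun x => (h0 x).2.2,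
    fun x => (hrel 0 x 0 (h0 x).1 1 le_rfl (by omega)).1, fun i x => ?_, fun i x hs => ?_,
    fun i x hs => ?_⟩
  · obtain ⟨p, hp, hz, hne⟩ := key x i
    exact (hrel p x _ hz (i + 1) (by omega) hne).2
  · exact (hrel (i + 1) x _ hs (i + 2) le_rfl (by omega)).1
  · obtain ⟨p, hp, hz, hne⟩ := key x i
    refine (hrel p x _ hz (i + 2) (by omega) fun h h₁ h₂ => ?_).1
    obtain h₂ | rfl : h < i + 1 ∨ h = i + 1 := by omega
    · exact hne h h₁ h₂
    · exact hs

/-- The copy that is active in the next position carries the value of the clock after the resets. -/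
theorem CopyDiscipline.clk_active_succ {m : N.Model} (hm : CopyDiscipline m) (i : ℕ) (x : X) :
    m.clk i (x, active m x (i + 1)) = settledVal m i x := by
  cases i with
  | zero =>
    rw [hm.active_one, (hm.clk_zero x).1, settledVal_of_hasReset (.inl (hm.clk_zero x).1)]
  | succ i =>
    have hpos : m.clk (i + 1) (x, active m x (i + 1)) ≠ 0 := (hm.pos i x).ne'
    have hr := hasReset_iff m (i + 1) x (active m x (i + 1))
    by_cases hs : m.clk (i + 1) (x, active m x (i + 1) + 1) = 0
    · rw [hm.switch i x hs, hs, settledVal_of_hasReset (hr.2 (.inr hs))]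
    · rw [hm.keep i x hs, settledVal_of_not_hasReset (mt hr.1 (by tauto)), activeVal]

/-- Active copies cannot be reset in the step that leads to them, so they progress. -/
theorem CopyDiscipline.exists_delay {m : N.Model} (hm : CopyDiscipline m) :
    ∃ δ : ℕ → ℝ, (∀ i, 0 < δ i) ∧
      ∀ i x, (activeVal m (i + 1) x : ℝ) = settledVal m i x + δ i := by
  obtain ⟨δ, hδ, hstep, -⟩ := m.isClock
  refine ⟨δ, hδ, fun i x => ?_⟩
  rw [← hm.clk_active_succ]
  exact (hstep i _).resolve_right (hm.pos i x).ne'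

/-! ### Alternating sequences as runs -/

namespace AltRun

variable (a : N.AltRun) (h : ℕ)

@[simp] theorem toRun_conf_even : a.toRun.conf (2 * h) = a.conf h := by simp [toRun]

@[simp] theorem toRun_conf_odd : a.toRun.conf (2 * h + 1) = a.conf' h := by
  simp [toRun, Nat.mul_add_div]

@[simp] theorem toRun_ev_even : a.toRun.ev (2 * h) = .delay (a.delay h) := by simp [toRun]

@[simp] theorem toRun_ev_odd : a.toRun.ev (2 * h + 1) = .disc (a.symb h) := by
  simp [toRun, Nat.mul_add_div]

variable {a}

theorem toRun_ev_eq_disc {i : ℕ} {Λ : N.Symbols} :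
    a.toRun.ev i = .disc Λ ↔ ∃ h, i = 2 * h + 1 ∧ a.symb h = Λ := by
  constructor
  · intro hi
    obtain ⟨h, rfl | rfl⟩ := Nat.even_or_odd' i
    · simp at hi
    · exact ⟨h, rfl, by simpa using hi⟩
  · rintro ⟨h, rfl, rfl⟩
    simp

theorem isDelay_toRun {i : ℕ} : a.toRun.IsDelay i ↔ ∃ h, i = 2 * h := by
  constructor
  · rintro ⟨δ, hi⟩
    obtain ⟨h, rfl | rfl⟩ := Nat.even_or_odd' i
    · exact ⟨h, rfl⟩
    · simp at hi
  · rintro ⟨h, rfl⟩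
    exact ⟨_, a.toRun_ev_even h⟩

theorem moves_toRun {i : ℕ} {k : Fin K} :
    Moves a.toRun i k ↔ ∃ h, i = 2 * h + 1 ∧ a.symb h k ≠ none := by
  simp only [Moves, toRun_ev_eq_disc]
  constructor
  · rintro ⟨_, ⟨h, hi, rfl⟩, hk⟩
    exact ⟨h, hi, hk⟩
  · rintro ⟨h, hi, hk⟩
    exact ⟨_, ⟨h, hi, rfl⟩, hk⟩

theorem ready_toRun {i : ℕ} {k : Fin K} :
    Ready a.toRun i k ↔ ∃ h, i = 2 * h + 0 ∧ ∃ t, N.Enabled k t (a.conf' h) := by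
  rw [Ready, isDelay_toRun]
  constructor
  · rintro ⟨⟨h, rfl⟩, hk⟩
    exact ⟨h, rfl, by simpa using hk⟩
  · rintro ⟨h, rfl, hk⟩
    exact ⟨⟨h, rfl⟩, by simpa using hk⟩

theorem isSync_toRun {c : SyncKind} :
    IsSync a.toRun c ↔ ∀ h, Synchronizes (a.conf' h) (a.symb h) c := by
  simp only [IsSync, toRun_ev_eq_disc]
  constructor
  · intro H h
    simpa using H _ _ ⟨h, rfl, rfl⟩
  · rintro H _ _ ⟨h, rfl, rfl⟩
    simpa using H h

end AltRun

/-- Something happens infinitely often at positions of the form `2h + b` exactly if it happens for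
infinitely many `h`. -/
theorem forall_exists_double_iff (b : ℕ) (P : ℕ → Prop) :
    (∀ i, ∃ j, i < j ∧ ∃ h, j = 2 * h + b ∧ P h) ↔ ∀ i, ∃ j, i ≤ j ∧ P j := by
  constructor
  · intro H i
    obtain ⟨_, hlt, h, rfl, hP⟩ := H (2 * i + b)
    exact ⟨h, by omega, hP⟩
  · intro H i
    obtain ⟨h, hle, hP⟩ := H (i + 1)
    exact ⟨2 * h + b, by omega, h, rfl, hP⟩

/-! ### The alternating sequence of a model -/

/-- The transition that automaton `k` takes in position `h` of a model. -/
def modelTrn (m : N.Model) (h : ℕ) : N.Choice := fun k =>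
  decode (N.aut k).nTrans (m.val h (.trn k))

theorem code_modelTrn (m : N.Model) (h : ℕ) (k : Fin K) :
    code (modelTrn m h k) = m.val h (.trn k) :=
  code_decode (m.mem_dom h (.trn k))

@[simp] theorem sat_takes (m : N.Model) (h : ℕ) (k : Fin K) (t : Fin (N.aut k).nTrans) :
    m.sat (N.takes k t) h ↔ modelTrn m h k = some t := by
  rw [takes, sat_eqC, ← code_modelTrn]
  exact code_injective.eq_iff (b := some t)

@[simp] theorem sat_takesNone (m : N.Model) (h : ℕ) (k : Fin K) :
    m.sat (N.takesNone k) h ↔ modelTrn m h k = none := by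
  rw [takesNone, sat_eqC, ← code_modelTrn]
  exact code_injective.eq_iff (b := none)

open Classical in
/-- The kind of edge of automaton `k` in the change of position `h` of a model. -/
noncomputable def modelEdge (m : N.Model) (h : ℕ) (k : Fin K) : EdgeKind :=
  if .edge k ∈ m.prop (h + 1) then .ie else .ei

theorem modelEdge_eq_ie {m : N.Model} {h : ℕ} {k : Fin K} :
    modelEdge m h k = .ie ↔ .edge k ∈ m.prop (h + 1) := by
  unfold modelEdge; split_ifs with hk <;> simp [hk]

theorem modelEdge_eq_ei {m : N.Model} {h : ℕ} {k : Fin K} :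
    modelEdge m h k = .ei ↔ .edge k ∉ m.prop (h + 1) := by
  unfold modelEdge; split_ifs with hk <;> simp [hk]

theorem modelEdge_eq_modelEdge {m : N.Model} {h : ℕ} {k k' : Fin K} :
    modelEdge m h k = modelEdge m h k' ↔
      (.edge k ∈ m.prop (h + 1) ↔ .edge k' ∈ m.prop (h + 1)) := by
  unfold modelEdge; split_ifs with hk hk' <;> simp [*]

section AltOfModel

variable [Nonempty X] (m : N.Model) (h : ℕ)

@[simp] theorem altOfModel_loc : ((altOfModel m).conf h).loc = modelLoc m h := rfl

@[simp] theorem altOfModel_var : ((altOfModel m).conf h).var = fun n => m.val h (.int n) := rfl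

@[simp] theorem altOfModel_clk : ((altOfModel m).conf h).clk = settledVal m h := by
  funext x
  simp only [altOfModel, settledVal, HasReset, activeVal]
  congr

@[simp] theorem altOfModel_loc' : ((altOfModel m).conf' h).loc = modelLoc m h := rfl

@[simp] theorem altOfModel_var' : ((altOfModel m).conf' h).var = fun n => m.val h (.int n) := rfl

@[simp] theorem altOfModel_clk' : ((altOfModel m).conf' h).clk = activeVal m (h + 1) := rfl

theorem altOfModel_symb (k : Fin K) : (altOfModel m).symb h k =
    (modelTrn m h k).map fun t => (((N.aut k).trans t).action, modelEdge m h k) := rfl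

variable {m h}

theorem altOfModel_symb_eq_some {k : Fin K} {α : Action Act} {b : EdgeKind} :
    (altOfModel m).symb h k = some (α, b) ↔
      (∃ t, modelTrn m h k = some t ∧ ((N.aut k).trans t).action = α) ∧ modelEdge m h k = b := by
  simp only [altOfModel_symb, Option.map_eq_some_iff, Prod.mk.injEq]
  tauto

theorem altOfModel_symb_eq_none {k : Fin K} :
    (altOfModel m).symb h k = none ↔ modelTrn m h k = none := by
  simp [altOfModel_symb]

theorem performs_altOfModel {k : Fin K} {e : Act} {s : Prim} :
    Performs ((altOfModel m).symb h) k e s ↔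
      ∃ t, modelTrn m h k = some t ∧ ((N.aut k).trans t).action = .sync e s := by
  simp only [Performs, altOfModel_symb_eq_some, exists_and_left, exists_eq', and_true]

theorem Performs.sameEdge_iff {k k' : Fin K} {e e' : Act} {s s' : Prim}
    (hk : Performs ((altOfModel m).symb h) k e s) (hk' : Performs ((altOfModel m).symb h) k' e' s') :
    SameEdge ((altOfModel m).symb h) k k' ↔ modelEdge m h k = modelEdge m h k' := by
  obtain ⟨b, hb⟩ := hk
  obtain ⟨b', hb'⟩ := hk'
  have h₁ := (altOfModel_symb_eq_some.1 hb).2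
  have h₂ := (altOfModel_symb_eq_some.1 hb').2
  simp [SameEdge, hb, hb', h₁, h₂, eq_comm]

end AltOfModel

/-! ### The formulae about discrete transitions -/

section DiscreteSteps

variable (m : N.Model) (h : ℕ)

theorem sat_varphi₄ : m.sat N.varphi₄ h ↔ ∀ k, modelTrn m h k = none →
    ((N.aut k).inv (modelLoc m h k)).Sat (activeVal m (h + 1)) ∧
      ((N.aut k).inv (modelLoc m h k)).Sat (settledVal m (h + 1)) := by
  simp [varphi₄, sat_phi_and_r₁]

theorem sat_varphi₅ : m.sat N.varphi₅ h ↔ ∀ k t, modelTrn m h k = some t →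
    modelLoc m h k = ((N.aut k).trans t).src ∧
    (((N.aut k).trans t).varGuard.Sat fun n => m.val h (.int n)) ∧
    (∀ a ∈ ((N.aut k).trans t).assigns,
      m.val (h + 1) (.int a.1) = a.2.eval fun n => m.val h (.int n)) ∧
    modelLoc m (h + 1) k = ((N.aut k).trans t).tgt ∧
    ((N.aut k).trans t).guard.Sat (activeVal m (h + 1)) ∧
    (∀ x ∈ ((N.aut k).trans t).resets, HasReset m (h + 1) x) ∧
    match modelEdge m h k with
    | .ei => ((N.aut k).inv ((N.aut k).trans t).src).WeakSat (activeVal m (h + 1)) ∧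
        ((N.aut k).inv ((N.aut k).trans t).tgt).Sat (settledVal m (h + 1))
    | .ie => ((N.aut k).inv ((N.aut k).trans t).src).Sat (activeVal m (h + 1)) ∧
        ((N.aut k).inv ((N.aut k).trans t).tgt).WeakSat (settledVal m (h + 1)) := by
  simp only [varphi₅, Interp.sat_all, Finset.mem_univ, true_imp_iff, Interp.sat_imp, sat_takes,
    Interp.sat_and, sat_atLoc, sat_phiVar, sat_phiAssign, Interp.sat_next, sat_phi, sat_phiReset,
    phiEdge, Interp.sat_or, sat_r₂Weak, Interp.sat_prop, sat_phiWeak, sat_r₂, Interp.sat_not]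
  refine forall₂_congr fun k t => imp_congr_right fun _ => and_congr_right fun _ =>
    and_congr_right fun _ => and_congr_right fun _ => and_congr_right fun _ =>
    and_congr_right fun _ => and_congr_right fun _ => ?_
  by_cases hk : PropSym.edge k ∈ m.prop (h + 1)
  · simp [hk, modelEdge]
  · simp [hk, modelEdge]

theorem sat_varphi₆ : m.sat N.varphi₆ h ↔ ∀ k, modelLoc m h k ≠ modelLoc m (h + 1) k →
    ∃ t, (((N.aut k).trans t).src = modelLoc m h k ∧
      ((N.aut k).trans t).tgt = modelLoc m (h + 1) k) ∧ modelTrn m h k = some t := by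
  simp only [varphi₆, Interp.sat_all, Finset.mem_univ, true_imp_iff, Interp.sat_imp, Interp.sat_and,
    Interp.sat_next, Interp.sat_any, sat_atLoc, sat_takes, Finset.mem_filter, true_and]
  refine forall_congr' fun k => ⟨fun H hne => H (_, _) hne ⟨rfl, rfl⟩, ?_⟩
  rintro H ⟨q, q'⟩ hne ⟨hq, hq'⟩
  dsimp only at hne hq hq' ⊢
  subst hq hq'
  exact H hne

theorem sat_varphi₇ [Fintype X] : m.sat N.varphi₇ h ↔ ∀ x, HasReset m (h + 1) x →
    ∃ k t, x ∈ ((N.aut k).trans t).resets ∧ modelTrn m h k = some t := by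
  simp [varphi₇]

theorem sat_varphi₈ [Fintype V] : m.sat N.varphi₈ h ↔ ∀ n, m.val (h + 1) (.int n) ≠ m.val h (.int n) →
    ∃ k t, n ∈ ((N.aut k).trans t).updated ∧ modelTrn m h k = some t := by
  simp [varphi₈, Interp.sat, CRel.holds, Expr.eval]

variable {m} in
/-- `φ₄`, …, `φ₈` together say that a discrete transition takes place. The clock discipline enters
through `φ₇` only: a clock that no transition resets keeps its value, which is positive after a
delay. -/
theorem CopyDiscipline.sat_steps_iff [Fintype X] [Nonempty X] [Fintype V] (hm : CopyDiscipline m) :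
    (m.sat N.varphi₄ h ∧ m.sat N.varphi₅ h ∧ m.sat N.varphi₆ h ∧ m.sat N.varphi₇ h ∧
      m.sat N.varphi₈ h) ↔
    N.DiscreteStepVia (modelTrn m h) ((altOfModel m).conf' h) ((altOfModel m).symb h)
      ((altOfModel m).conf (h + 1)) := by
  rw [sat_varphi₄, sat_varphi₅, sat_varphi₆, sat_varphi₇, sat_varphi₈]
  constructor
  · rintro ⟨h₄, h₅, h₆, h₇, h₈⟩
    refine ⟨fun k t hk => ⟨modelEdge m h k, ?_, ?_⟩, fun k hk => ?_, fun x hx => ?_, fun n hn => ?_⟩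
    · exact altOfModel_symb_eq_some.2 ⟨⟨t, hk, rfl⟩, rfl⟩
    · obtain ⟨hs, hv, ha, ht, hg, hr, hi⟩ := h₅ k t hk
      refine ⟨hs.symm, ht.symm, hg, hv, fun x hx => ?_, ha, ?_⟩
      · simpa [settledVal_eq_zero] using hr x hx
      · cases hb : modelEdge m h k <;> simpa [hb, hs, ht] using hi
    · have hloc : modelLoc m (h + 1) k = modelLoc m h k := by
        by_contra hne
        obtain ⟨t, -, ht⟩ := h₆ k (Ne.symm hne)
        simp [hk] at ht
      refine ⟨altOfModel_symb_eq_none.2 hk, hloc, ?_⟩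
      simpa [hloc] using h₄ k hk
    · simp only [altOfModel_clk, altOfModel_clk']
      refine settledVal_of_not_hasReset fun hr => ?_
      obtain ⟨k, t, hxt, hk⟩ := h₇ x hr
      exact hx k t hk hxt
    · by_contra hne
      obtain ⟨k, t, hnt, hk⟩ := h₈ n hne
      exact hn k t hk hnt
  · rintro ⟨hf, hidle, hclk, hvar⟩
    refine ⟨fun k hk => ?_, fun k t hk => ?_, fun k hne => ?_, fun x hx => ?_, fun n hne => ?_⟩
    · obtain ⟨-, hloc, h₁, h₂⟩ := hidle k hk
      rw [hloc] at h₂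
      simpa using And.intro h₁ h₂
    · obtain ⟨b, hb, hs, ht, hg, hv, hr, ha, hi⟩ := hf k t hk
      rw [(altOfModel_symb_eq_some.1 hb).2, hs, ht]
      refine ⟨rfl, hv, ha, rfl, hg, fun x hx => settledVal_eq_zero.1 ?_, ?_⟩
      · simpa using hr x hx
      · cases b <;> simpa using hi
    · cases hk : modelTrn m h k with
      | none => exact absurd (hidle k hk).2.1.symm hne
      | some t =>
        obtain ⟨b, -, hF⟩ := hf k t hk
        exact ⟨t, ⟨hF.src, hF.tgt⟩, rfl⟩
    · by_contra! hno
      have := hclk x fun k t hk hxt => hno k t hxt hk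
      simp only [altOfModel_clk, altOfModel_clk', settledVal_of_hasReset hx] at this
      exact (hm.pos h x).ne this
    · by_contra! hno
      exact hne (hvar n fun k t hk hnt => hno k t hnt hk)

end DiscreteSteps

/-! ### Liveness, synchronization and edges -/

section Conditions

variable (m : N.Model) (h : ℕ)

theorem sat_phiEnabled [Nonempty X] (k : Fin K) (t : Fin (N.aut k).nTrans) :
    m.sat (N.phiEnabled k t) h ↔ N.Enabled k t ((altOfModel m).conf' h) := by
  simp only [phiEnabled, Enabled, Interp.sat_and, sat_atLoc, sat_phiVar, Interp.sat_next, sat_phi,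
    altOfModel_loc', altOfModel_clk', altOfModel_var', @eq_comm _ (modelLoc m h k)]
  tauto

theorem sat_syncOn [Nonempty X] (k : Fin K) (e : Act) (s : Prim) :
    m.sat (N.syncOn k (.sync e s)) h ↔ Performs ((altOfModel m).symb h) k e s := by
  simp [syncOn, performs_altOfModel, and_comm]

theorem sat_syncOnBut [Nonempty X] (S : Finset (Fin K)) (e : Act) (s : Prim) :
    m.sat (N.syncOnBut S (.sync e s)) h ↔
      ∃ k, k ∉ S ∧ Performs ((altOfModel m).symb h) k e s := by
  simp [syncOnBut, sat_syncOn]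

theorem sat_sameEdge (k k' : Fin K) :
    m.sat (N.sameEdge k k') h ↔ modelEdge m h k = modelEdge m h k' := by
  simp [sameEdge, modelEdge_eq_modelEdge]

theorem sat_whenever [Nonempty X] (s : Prim) (f : Fin K → Act → N.Form) :
    m.sat (N.whenever s f) h ↔
      ∀ k e, Performs ((altOfModel m).symb h) k e s → m.sat (f k e) h := by
  simp only [whenever, Interp.sat_all, Finset.mem_univ, true_imp_iff, performs_altOfModel]
  refine forall_congr' fun k => ⟨?_, fun hf t => ?_⟩
  · rintro hf e ⟨t, ht, ha⟩
    simpa [ha, ht] using hf t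
  · split
    · simp
    · next e s' ha =>
      split_ifs with hs
      · subst hs
        exact (Interp.sat_imp ..).2 fun ht => hf e ⟨t, (sat_takes ..).1 ht, ha⟩
      · simp

theorem sat_phiSync [Nonempty X] (c : SyncKind) : m.sat (N.phiSync c) 0 ↔
    ∀ h, Synchronizes ((altOfModel m).conf' h) ((altOfModel m).symb h) c := by
  cases c with
  | channel =>
    simp only [phiSync, Interp.sat_globally, Nat.zero_le, true_imp_iff, Interp.sat_and, sat_whenever,
      Interp.sat_any, Interp.sat_not, sat_syncOn, sat_syncOnBut, sat_sameEdge, Synchronizes]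
    refine forall_congr' fun h => ⟨fun ⟨hs, hr⟩ k e => ⟨fun hk => ?_, fun hk => ?_⟩, fun H =>
      ⟨fun k e hk => ?_, fun k e hk => ?_⟩⟩
    · obtain ⟨k', hne, hk', hb, he⟩ := hs k e hk
      have huniq : ∀ g, g ≠ k → Performs ((altOfModel m).symb h) g e .recv → g = k' :=
        fun g hg hp => by_contra fun hg' => hb ⟨g, by simp [hg, hg'], hp⟩
      refine ⟨⟨k', ⟨by simpa using hne, hk'⟩, fun g hg => huniq g hg.1 hg.2⟩, fun g hg hp => ?_⟩
      obtain rfl := huniq g hg hp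
      exact (hk.sameEdge_iff hp).2 he
    · obtain ⟨k', hne, hk', hb⟩ := hr k e hk
      have huniq : ∀ g, g ≠ k → Performs ((altOfModel m).symb h) g e .send → g = k' :=
        fun g hg hp => by_contra fun hg' => hb ⟨g, by simp [hg, hg'], hp⟩
      refine ⟨⟨k', ⟨by simpa using hne, hk'⟩, fun g hg => huniq g hg.1 hg.2⟩, fun g hg hp => ?_⟩
      -- The edge condition is the one imposed on the sender, whose only receiver is `k`.
      obtain ⟨k'', hne'', -, hb'', he⟩ := hs g e hp
      have : k = k'' := by_contra fun hk' => hb'' ⟨k, by simp [hg.symm, hk'], hk⟩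
      subst this
      exact (hk.sameEdge_iff hp).2 he.symm
    · obtain ⟨⟨k', ⟨hne, hk'⟩, hu⟩, he⟩ := (H k e).1 hk
      refine ⟨k', by simpa using hne, hk', ?_, (hk.sameEdge_iff hk').1 (he k' hne hk')⟩
      rintro ⟨g, hg, hp⟩
      simp only [Finset.mem_insert, Finset.mem_singleton, not_or] at hg
      exact hg.2 (hu g ⟨hg.1, hp⟩)
    · obtain ⟨⟨k', ⟨hne, hk'⟩, hu⟩, he⟩ := (H k e).2 hk
      refine ⟨k', by simpa using hne, hk', ?_⟩
      rintro ⟨g, hg, hp⟩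
      simp only [Finset.mem_insert, Finset.mem_singleton, not_or] at hg
      exact hg.2 (hu g ⟨hg.1, hp⟩)
  | broadcast =>
    have hen : ∀ h k' t, (¬ ((N.aut k').trans t).guard.Sat (activeVal m (h + 1)) ∨
        ¬ (((N.aut k').trans t).varGuard.Sat fun n => m.val h (.int n)) ∨
        ¬ modelLoc m h k' = ((N.aut k').trans t).src) ↔
        ¬ N.Enabled k' t ((altOfModel m).conf' h) := by
      intro h k' t
      simp only [Enabled, altOfModel_loc', altOfModel_clk', altOfModel_var',
        @eq_comm _ (modelLoc m h k')]
      tauto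
    simp only [phiSync, Interp.sat_globally, Nat.zero_le, true_imp_iff, Interp.sat_and, sat_whenever,
      Interp.sat_all, Interp.sat_or, Interp.sat_next, Interp.sat_not, sat_syncOn, sat_syncOnBut,
      sat_sameEdge, Synchronizes, Finset.mem_sdiff, Finset.mem_univ, Finset.mem_singleton,
      true_and, Finset.mem_filter, sat_phi, sat_phiVar, sat_atLoc, hen]
    refine forall_congr' fun h => ⟨fun ⟨⟨h₁, h₂⟩, h₃⟩ k e => ⟨fun hk k' hne => ⟨fun hk' => ?_, ?_⟩,
      h₃ k e⟩, fun H => ⟨⟨fun k e hk => ?_, fun k e hk k' hne => ?_⟩, fun k e => (H k e).2⟩⟩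
    · exact h₁ k e hk ⟨k', hne, hk'⟩
    · exact (h₂ k e hk k' hne).imp_left fun ⟨hk', he⟩ => ⟨hk', (hk.sameEdge_iff hk').2 he⟩
    · rintro ⟨k', hne, hk'⟩
      exact ((H k e).1 hk k' hne).1 hk'
    · exact ((H k e).1 hk k' hne).2.imp_left fun ⟨hk', he⟩ => ⟨hk', (hk.sameEdge_iff hk').1 he⟩
  | oneToMany =>
    simp only [phiSync, Interp.sat_globally, Nat.zero_le, true_imp_iff, Interp.sat_and, sat_whenever,
      Interp.sat_not, sat_syncOnBut, Synchronizes, Finset.mem_singleton, not_exists, not_and,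
      forall_and]

theorem sat_phiEF [Nonempty X] (c : EdgeRestriction) : m.sat (N.phiEF c) 0 ↔
    RespectsEdge (rhoInv m) c := by
  cases c with
  | closedOpen =>
    simp only [phiEF, Interp.sat_globally, Nat.zero_le, true_imp_iff, Interp.sat_all, Finset.mem_univ,
      Interp.sat_imp, Interp.sat_not, sat_takesNone, Interp.sat_next, Interp.sat_prop,
      ← modelEdge_eq_ie, RespectsEdge, rhoInv, AltRun.toRun_ev_eq_disc]
    constructor
    · rintro H _ _ ⟨h, -, rfl⟩ k α b hk
      obtain ⟨⟨t, ht, -⟩, rfl⟩ := altOfModel_symb_eq_some.1 hk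
      exact H h k (by simp [ht])
    · intro H h k hk
      obtain ⟨t, ht⟩ := Option.ne_none_iff_exists'.1 hk
      exact H _ _ ⟨h, rfl, rfl⟩ k _ _ (altOfModel_symb_eq_some.2 ⟨⟨t, ht, rfl⟩, rfl⟩)
  | openClosed =>
    simp only [phiEF, Interp.sat_globally, Nat.zero_le, true_imp_iff, Interp.sat_all, Finset.mem_univ,
      Interp.sat_imp, Interp.sat_not, sat_takesNone, Interp.sat_next, Interp.sat_prop,
      ← modelEdge_eq_ei, RespectsEdge, rhoInv, AltRun.toRun_ev_eq_disc]
    constructor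
    · rintro H _ _ ⟨h, -, rfl⟩ k α b hk
      obtain ⟨⟨t, ht, -⟩, rfl⟩ := altOfModel_symb_eq_some.1 hk
      exact H h k (by simp [ht])
    · intro H h k hk
      obtain ⟨t, ht⟩ := Option.ne_none_iff_exists'.1 hk
      exact H _ _ ⟨h, rfl, rfl⟩ k _ _ (altOfModel_symb_eq_some.2 ⟨⟨t, ht, rfl⟩, rfl⟩)
  | unrestricted => simp [phiEF, RespectsEdge]

theorem sat_phiLive [Nonempty X] (c : Liveness) : m.sat (N.phiLive c) 0 ↔
    IsLive (rhoInv m) c := by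
  cases c with
  | strongTransition =>
    simp only [phiLive, IsLive, Interp.sat_all, Finset.mem_univ, true_imp_iff, Interp.sat_globally,
      Nat.zero_le, Interp.sat_eventually, Interp.sat_any, true_and, sat_takes, rhoInv,
      AltRun.moves_toRun, ne_eq, altOfModel_symb_eq_none, ← Option.ne_none_iff_exists']
    rw [@forall_comm ℕ]
    exact forall_congr' fun k => (forall_exists_double_iff 1 _).symm
  | weakTransition =>
    simp only [phiLive, IsLive, Interp.sat_globally, Nat.zero_le, true_imp_iff,
      Interp.sat_eventually, Interp.sat_any, Finset.mem_univ, true_and, sat_takes, rhoInv,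
      AltRun.moves_toRun, ne_eq, altOfModel_symb_eq_none, ← Option.ne_none_iff_exists']
    -- Discrete transitions are the events with odd index, delays those with even index.
    rw [← forall_exists_double_iff 1]
    exact forall_congr' fun i => ⟨fun ⟨j, hj, h, e, k, hk⟩ => ⟨k, j, hj, h, e, hk⟩,
      fun ⟨k, j, hj, h, e, hk⟩ => ⟨j, hj, h, e, k, hk⟩⟩
  | strongGuard =>
    simp only [phiLive, IsLive, Interp.sat_all, Finset.mem_univ, true_imp_iff, Interp.sat_globally,
      Nat.zero_le, Interp.sat_eventually, Interp.sat_any, true_and, sat_phiEnabled, rhoInv,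
      AltRun.ready_toRun]
    rw [forall_comm, @forall_comm ℕ]
    exact forall_congr' fun k => (forall_exists_double_iff 0 _).symm
  | weakGuard =>
    simp only [phiLive, IsLive, Interp.sat_globally, Nat.zero_le, true_imp_iff,
      Interp.sat_eventually, Interp.sat_any, Finset.mem_univ, true_and, sat_phiEnabled, rhoInv,
      AltRun.ready_toRun]
    refine Iff.trans ?_ ((forall_exists_double_iff 0
      fun h => ∃ k t, N.Enabled k t ((altOfModel m).conf' h)).symm.trans ?_)
    · exact forall_congr' fun i => ⟨fun ⟨k, j, hj, ht⟩ => ⟨j, hj, k, ht⟩,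
        fun ⟨j, hj, k, ht⟩ => ⟨k, j, hj, ht⟩⟩
    · exact forall_congr' fun i => ⟨fun ⟨j, hj, h, e, k, hk⟩ => ⟨k, j, hj, h, e, hk⟩,
        fun ⟨k, j, hj, h, e, hk⟩ => ⟨j, hj, h, e, k, hk⟩⟩

end Conditions

/-! ### Alternating forms of traces -/

/-- What is needed of the map `f` of an alternating form: event `i` of `η` is event `f i` of `a`, and
all other events of `a` are empty. -/
structure AltIndex (η : N.Run) (a : N.AltRun) (f : ℕ → ℕ) : Prop where
  conf : ∀ i, a.toRun.conf (f i) = η.conf i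
  ev : ∀ i, a.toRun.ev (f i) = η.ev i
  le : ∀ i, i ≤ f i
  /-- Also where an event is inserted, the configuration after event `i` is the same. -/
  conf_succ : ∀ i, a.toRun.conf (f i + 1) = η.conf (i + 1)
  surj : ∀ n, (∃ i, f i = n) ∨ a.toRun.ev n = .disc fun _ => none

theorem IsAltForm.exists_altIndex {η : N.Run} {a : N.AltRun} (h : IsAltForm η a) :
    ∃ f, AltIndex η a f ∧ f 0 = 0 := by
  obtain ⟨f, h0, heq, hins, hstep⟩ := h
  have hsucc : ∀ i, f (i + 1) = f i + 1 ∨ f (i + 1) = f i + 2 := fun i => by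
    by_cases hd : η.IsDelay i ∧ η.IsDelay (i + 1)
    exacts [.inr (hins i hd).1, .inl (hstep i hd)]
  refine ⟨f, ⟨fun i => (heq i).1, fun i => (heq i).2, fun i => ?_, fun i => ?_, fun n => ?_⟩, h0⟩
  · induction i with
    | zero => exact Nat.zero_le _
    | succ i ih => have := hsucc i; omega
  · by_cases hd : η.IsDelay i ∧ η.IsDelay (i + 1)
    · exact (hins i hd).2.1
    · rw [← hstep i hd]; exact (heq (i + 1)).1
  · have key : (∃ i, f i = n) ∨ ∃ i, (η.IsDelay i ∧ η.IsDelay (i + 1)) ∧ f i + 1 = n := by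
      induction n with
      | zero => exact .inl ⟨0, h0⟩
      | succ n ih =>
        obtain ⟨i, rfl⟩ | ⟨i, hd, rfl⟩ := ih
        · by_cases hd : η.IsDelay i ∧ η.IsDelay (i + 1)
          · exact .inr ⟨i, hd, rfl⟩
          · exact .inl ⟨i + 1, hstep i hd⟩
        · exact .inl ⟨i + 1, (hins i hd).1⟩
    refine key.imp_right ?_
    rintro ⟨i, hd, rfl⟩
    exact (hins i hd).2.2

namespace AltIndex

variable {η : N.Run} {a : N.AltRun} {f : ℕ → ℕ} (hf : AltIndex η a f)
include hf

theorem timeStep (hη : N.IsTrace η) (h : ℕ) : N.TimeStep (a.conf h) (a.delay h) (a.conf' h) := by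
  obtain ⟨i, hi⟩ | hn := hf.surj (2 * h)
  · have hs := hη.step i
    have he := hf.ev i
    have hc := hf.conf i
    have hc' := hf.conf_succ i
    simp only [hi, AltRun.toRun_ev_even, AltRun.toRun_conf_even, AltRun.toRun_conf_odd] at he hc hc'
    rwa [← he, ← hc, ← hc'] at hs
  · simp at hn

theorem isLive {c : Liveness} (h : IsLive η c) : IsLive a.toRun c := by
  have moves : ∀ {j k}, Moves η j k → Moves a.toRun (f j) k := by
    rintro j k ⟨Λ, hΛ, hk⟩
    exact ⟨Λ, (hf.ev j).trans hΛ, hk⟩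
  have ready : ∀ {j k}, Ready η j k → Ready a.toRun (f j) k := by
    rintro j k ⟨⟨δ, hδ⟩, hk⟩
    exact ⟨⟨δ, (hf.ev j).trans hδ⟩, by rwa [hf.conf_succ]⟩
  cases c with
  | strongTransition =>
    intro i k
    obtain ⟨j, hj, hm⟩ := h i k
    exact ⟨f j, hj.trans_le (hf.le j), moves hm⟩
  | weakTransition =>
    intro i
    obtain ⟨k, j, hj, hm⟩ := h i
    exact ⟨k, f j, hj.trans_le (hf.le j), moves hm⟩
  | strongGuard =>
    intro i k
    obtain ⟨j, hj, hm⟩ := h i k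
    exact ⟨f j, hj.trans_le (hf.le j), ready hm⟩
  | weakGuard =>
    intro i
    obtain ⟨k, j, hj, hm⟩ := h i
    exact ⟨k, f j, hj.trans_le (hf.le j), ready hm⟩

theorem isSync {c : SyncKind} (h : IsSync η c) : IsSync a.toRun c := by
  intro n Λ hn
  obtain ⟨i, rfl⟩ | hn' := hf.surj n
  · rw [hf.conf]
    exact h i Λ ((hf.ev i).symm.trans hn)
  · obtain rfl : (fun _ => none) = Λ := by simpa using hn'.symm.trans hn
    cases c <;> simp [Synchronizes, Performs]

theorem respectsEdge {c : EdgeRestriction} (h : RespectsEdge η c) : RespectsEdge a.toRun c := by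
  cases c with
  | unrestricted => trivial
  | closedOpen | openClosed =>
    intro n Λ hn
    obtain ⟨i, rfl⟩ | hn' := hf.surj n
    · exact h i Λ ((hf.ev i).symm.trans hn)
    · obtain rfl : (fun _ => none) = Λ := by simpa using hn'.symm.trans hn
      simp

end AltIndex

/-! ### Models that represent an alternating sequence -/

/-- Since delays are positive, a copy is zero after a delay exactly if the clock is reset, so the two
ways of describing when the copies are exchanged agree. -/
theorem Represents.copyDiscipline {a : N.AltRun} {m : N.Model} (hm : Represents a m)
    (hδ : ∀ h, 0 < a.delay h) : CopyDiscipline m := by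
  have hact : ∀ {i j : ℕ} {x : X}, m.val i (.act x) = m.val j (.act x) →
      active m x i = active m x j := fun h => by simp only [active, h]
  have hne : ∀ {i x}, m.clk (i + 1) (x, active m x (i + 1) + 1) = 0 ↔
      (a.conf (i + 1)).clk x = 0 := by
    intro i x
    refine ⟨fun h => by_contra fun hc => ?_, hm.clk_reset i x⟩
    have := hm.clk_inactive i x hc
    rw [h] at this
    have h₁ := (m.clk i (x, active m x (i + 1) + 1)).coe_nonneg
    have h₂ := hδ i
    simp only [NNReal.coe_zero] at this
    linarith
  refine ⟨hm.clk_zero, fun x => by simp [active, hm.act_zero], fun x => by simp [active, hm.act_zero],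
    fun i x => ?_, fun i x hs => ?_, fun i x hs => hact (hm.act_keep i x (mt hne.2 hs))⟩
  · rw [← NNReal.coe_pos, activeVal, hm.clk_active]
    have := hδ i
    positivity
  · have h := hm.act_switch i x (hne.1 hs)
    rw [val_act, val_act] at h
    generalize active m x (i + 1) = j at h ⊢
    generalize active m x (i + 2) = j' at h ⊢
    omega

/-- A choice of transitions can be read off from any model that represents the sequence. -/
theorem Represents.discreteStepVia {a : N.AltRun} {m : N.Model} (hm : Represents a m) (h : ℕ) :
    N.DiscreteStepVia (modelTrn m h) (a.conf' h) (a.symb h) (a.conf (h + 1)) := by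
  obtain ⟨ts, hts, hcode⟩ := hm.trn h
  rwa [show modelTrn m h = ts from
    funext fun k => code_injective ((code_modelTrn m h k).trans (hcode k))]

/-- `ρ⁻¹` undoes `ρ`. -/
theorem Represents.eq_altOfModel [Nonempty X] {a : N.AltRun} {m : N.Model} (hm : Represents a m)
    (hstep : ∀ h, N.TimeStep (a.conf h) (a.delay h) (a.conf' h))
    (h0 : ∀ x, (a.conf 0).clk x = 0) : a = altOfModel m := by
  have hC := hm.copyDiscipline fun h => (hstep h).pos
  have hloc : ∀ h, (a.conf h).loc = modelLoc m h := by
    intro h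
    funext k
    simp [modelLoc, hm.loc]
  have hvar : ∀ h, (a.conf h).var = fun n => m.val h (.int n) := fun h =>
    funext fun n => (hm.var h n).symm
  have hclk' : ∀ h, (a.conf h).clk = settledVal m h → (a.conf' h).clk = activeVal m (h + 1) := by
    intro h hc
    funext x
    rw [← NNReal.coe_inj, (hstep h).clk, hc, activeVal, hm.clk_active, hC.clk_active_succ]
  have hclk : ∀ h, (a.conf h).clk = settledVal m h := by
    intro h
    induction h with
    | zero =>
      funext x
      rw [h0, settledVal_of_hasReset (.inl (hm.clk_zero x).1)]
    | succ h ih =>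
      funext x
      by_cases hx : (a.conf (h + 1)).clk x = 0
      · rw [hx, settledVal_of_hasReset]
        exact (hasReset_iff m _ x _).2 (.inr (hm.clk_reset h x hx))
      · have hd := hm.discreteStepVia h
        rw [hd.keepClk x, hclk' h ih, settledVal_of_not_hasReset]
        · rw [hasReset_iff m _ x (active m x (h + 1))]
          rintro (hr | hr)
          · exact (hC.pos h x).ne' hr
          · have := hm.clk_inactive h x hx
            rw [hr, NNReal.coe_zero] at this
            have h₁ := (m.clk h (x, active m x (h + 1) + 1)).coe_nonneg
            have h₂ := (hstep h).pos
            linarith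
        · intro k t hk hxt
          obtain ⟨b, -, hF⟩ := hd.fires k t hk
          exact hx (hF.resets x hxt)
  have hconf : a.conf = (altOfModel m).conf := by
    funext h
    ext1
    · rw [hloc, altOfModel_loc]
    · rw [hvar, altOfModel_var]
    · rw [hclk, altOfModel_clk]
  have hconf' : a.conf' = (altOfModel m).conf' := by
    funext h
    ext1
    · rw [(hstep h).loc, hloc, altOfModel_loc']
    · rw [(hstep h).var, hvar, altOfModel_var']
    · rw [hclk' h (hclk h), altOfModel_clk']
  have hdelay : a.delay = (altOfModel m).delay := by
    funext h
    simp only [altOfModel, hm.clk_active, add_sub_cancel_left]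
  have hsymb : a.symb = (altOfModel m).symb := by
    funext h k
    have hd := hm.discreteStepVia h
    rw [altOfModel_symb]
    cases hk : modelTrn m h k with
    | none => exact (hd.idle k hk).1
    | some t =>
      obtain ⟨b, hb, -⟩ := hd.fires k t hk
      have he := hm.edge h k _ b hb
      rw [← modelEdge_eq_ie] at he
      rw [hb, Option.map_some]
      cases hme : modelEdge m h k <;> cases b <;> simp_all
  cases a
  simp only at hconf hconf' hdelay hsymb
  subst hconf hconf' hdelay hsymb
  rfl

/-! ### Models of `φ_N` and traces -/

/-- Configurations at both ends of a discrete transition satisfy the invariants, at least weakly. -/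
theorem DiscreteStepVia.inv {ts : N.Choice} {c c' : N.Config} {Λ : N.Symbols}
    (h : N.DiscreteStepVia ts c Λ c') (k : Fin K) :
    (((N.aut k).inv (c.loc k)).Sat c.clk ∨ ((N.aut k).inv (c.loc k)).WeakSat c.clk) ∧
      (((N.aut k).inv (c'.loc k)).Sat c'.clk ∨ ((N.aut k).inv (c'.loc k)).WeakSat c'.clk) := by
  cases hk : ts k with
  | none =>
    obtain ⟨-, -, h₁, h₂⟩ := h.idle k hk
    exact ⟨.inl h₁, .inl h₂⟩
  | some t =>
    obtain ⟨b, -, hF⟩ := h.fires k t hk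
    have hi := hF.inv
    cases b with
    | ei => exact ⟨.inr hi.1, .inl hi.2⟩
    | ie => exact ⟨.inl hi.1, .inr hi.2⟩

theorem CopyDiscipline.settledVal_zero {m : N.Model} (hm : CopyDiscipline m) :
    settledVal m 0 = fun _ => 0 :=
  funext fun x => settledVal_of_hasReset (.inl (hm.clk_zero x).1)

theorem CopyDiscipline.activeVal_zero {m : N.Model} (hm : CopyDiscipline m) :
    activeVal m 0 = fun _ => 0 := by
  funext x
  rw [activeVal, hm.active_zero, (hm.clk_zero x).1]

/-- The content of `φ_N`: the initial conditions hold and every change of position is a discrete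
transition. Time transitions do not appear, as their existence follows. -/
theorem sat_varphiNet [Fintype X] [Nonempty X] [Fintype V] (m : N.Model) :
    m.sat N.varphiNet 0 ↔ CopyDiscipline m ∧ (∀ k, (modelLoc m 0 k : ℕ) = 0) ∧
      (∀ n, m.val 0 (.int n) = N.var₀ n) ∧
      (∀ k, ((N.aut k).inv (modelLoc m 0 k)).Sat (settledVal m 0)) ∧
      ∀ h, N.DiscreteStepVia (modelTrn m h) ((altOfModel m).conf' h) ((altOfModel m).symb h)
        ((altOfModel m).conf (h + 1)) := by
  have h₁ : m.sat N.varphi₁ 0 ↔ ∀ k, (modelLoc m 0 k : ℕ) = 0 := by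
    simp only [varphi₁, Interp.sat_all, Finset.mem_univ, true_imp_iff, sat_eqC, modelLoc]
    refine forall_congr' fun k => ?_
    have : 0 ≤ m.val 0 (.loc k) ∧ _ := m.mem_dom 0 (.loc k)
    omega
  have h₂ : m.sat N.varphi₂ 0 ↔ ∀ n, m.val 0 (.int n) = N.var₀ n := by simp [varphi₂]
  have h₃ : m.sat N.varphi₃ 0 ↔ ∀ k, ((N.aut k).inv (modelLoc m 0 k)).Sat (activeVal m 0) := by
    simp [varphi₃]
  have hC : m.sat N.phiClock 0 ↔ CopyDiscipline m :=
    ⟨copyDiscipline_of_sat, CopyDiscipline.sat_phiClock⟩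
  simp only [varphiNet, Interp.sat_and, Interp.sat_globally, Nat.zero_le, true_imp_iff, hC, h₁, h₂,
    h₃]
  refine and_congr_right fun hm => and_congr_right fun _ => and_congr_right fun _ => ?_
  rw [hm.activeVal_zero, hm.settledVal_zero]
  exact and_congr_right fun _ => forall_congr' fun h => hm.sat_steps_iff h

/-- The invariants that time transitions have to respect weakly hold, strongly or weakly, in the
adjacent discrete transitions, which suffices by `ClockConstraint.weakSat_of_delay`. -/
theorem isTrace_rhoInv [Fintype X] [Nonempty X] [Fintype V] {m : N.Model}
    (h : m.sat N.varphiNet 0) : N.IsTrace (rhoInv m) := by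
  obtain ⟨hm, hloc, hvar, hinv, hstep⟩ := (sat_varphiNet m).1 h
  obtain ⟨δ, hδ, hclk⟩ := hm.exists_delay
  have hdelay : ∀ i, (altOfModel m).delay i = δ i := fun i => by
    simp only [altOfModel, hm.clk_active_succ]
    exact sub_eq_of_eq_add' (hclk i _)
  have htime : ∀ i, N.TimeStep ((altOfModel m).conf i) ((altOfModel m).delay i)
      ((altOfModel m).conf' i) := by
    intro i
    refine ⟨hdelay i ▸ hδ i, rfl, rfl, fun x => ?_, fun k => ?_⟩
    · rw [hdelay, altOfModel_clk, altOfModel_clk', hclk]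
    · refine ClockConstraint.weakSat_of_delay (v := ((altOfModel m).conf i).clk) (fun x => ?_) ?_
        ((hstep i).inv k).1
      · rw [← NNReal.coe_lt_coe, altOfModel_clk, altOfModel_clk', hclk]
        linarith [hδ i]
      · cases i with
        | zero => exact .inl (by simpa using hinv k)
        | succ i => exact ((hstep i).inv k).2
  have hfirst : (altOfModel m).toRun.conf 0 = (altOfModel m).conf 0 :=
    (altOfModel m).toRun_conf_even 0
  unfold rhoInv
  refine ⟨fun i => ?_, AltRun.isDelay_toRun.2 ⟨0, rfl⟩, ?_, ?_, ?_, ?_, fun i hi => ?_,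
    fun i n => ?_⟩
  · obtain ⟨h, rfl | rfl⟩ := Nat.even_or_odd' i
    · simpa [Step] using htime h
    · simpa [Step, show 2 * h + 1 + 1 = 2 * (h + 1) by ring] using ⟨_, hstep h⟩
  · simpa [hfirst] using hloc
  · simpa [hfirst] using hinv
  · simp [hfirst, hm.settledVal_zero]
  · simpa [hfirst] using hvar
  · rw [AltRun.isDelay_toRun] at hi ⊢
    obtain ⟨h, rfl | rfl⟩ := Nat.even_or_odd' i
    · exact absurd ⟨h, rfl⟩ hi
    · exact ⟨h + 1, by ring⟩
  · obtain ⟨h, rfl | rfl⟩ := Nat.even_or_odd' i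
    · exact (AltRun.toRun_conf_even _ h).symm ▸ m.mem_dom h (.int n)
    · exact (AltRun.toRun_conf_odd _ h).symm ▸ m.mem_dom h (.int n)

/-- The three condition formulae hold in a model exactly if its alternating sequence satisfies the
corresponding conditions; this needs nothing of `φ_N`. -/
theorem isModel_Phi_iff [Fintype X] [Nonempty X] [Fintype V] (m : N.Model) (l : Finset Liveness)
    (s : Finset SyncKind) (ef : Finset EdgeRestriction) :
    m.IsModel (N.Phi l s ef) ↔ m.sat N.varphiNet 0 ∧ (∀ c ∈ l, IsLive (rhoInv m) c) ∧
      (∀ c ∈ s, IsSync (rhoInv m) c) ∧ ∀ c ∈ ef, RespectsEdge (rhoInv m) c := by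
  simp only [Interp.IsModel, Phi, Interp.sat_and, Interp.sat_all, sat_phiLive, sat_phiSync,
    sat_phiEF, rhoInv, AltRun.isSync_toRun]

theorem isModel_of_mem_rho [Fintype X] [Nonempty X] [Fintype V] {l : Finset Liveness}
    {s : Finset SyncKind} {ef : Finset EdgeRestriction} {η : N.Run} (hη : N.IsTrace η)
    (hl : ∀ c ∈ l, IsLive η c) (hs : ∀ c ∈ s, IsSync η c) (hef : ∀ c ∈ ef, RespectsEdge η c)
    {m : N.Model} (hm : m ∈ rho η) : m.IsModel (N.Phi l s ef) := by
  obtain ⟨a, ha, hm⟩ := hm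
  obtain ⟨f, hf, hf0⟩ := ha.exists_altIndex
  have hconf : a.conf 0 = η.conf 0 := by
    rw [← hf.conf, hf0]; exact (a.toRun_conf_even 0).symm
  have htime := hf.timeStep hη
  have hstep := hm.discreteStepVia
  have hC := hm.copyDiscipline fun h => (htime h).pos
  obtain rfl : a = altOfModel m :=
    hm.eq_altOfModel htime fun x => by rw [hconf]; exact hη.initClk x
  refine (isModel_Phi_iff m l s ef).2 ⟨(sat_varphiNet m).2 ⟨hC, ?_, ?_, ?_, hstep⟩,
    fun c hc => hf.isLive (hl c hc), fun c hc => hf.isSync (hs c hc),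
    fun c hc => hf.respectsEdge (hef c hc)⟩
  · simpa [← hconf] using hη.initLoc
  · simpa [← hconf] using hη.initVar
  · simpa [← hconf] using hη.initInv

end Network

end TimedNet

theorem mainTheorem3 {AP X Act V : Type*} [Fintype X] [Nonempty X] [Fintype V] {K : ℕ}
    (N : TimedNet.Network AP X Act V K)
    (l : Finset TimedNet.Network.Liveness) (s : Finset TimedNet.Network.SyncKind)
    (ef : Finset TimedNet.Network.EdgeRestriction) :
    (∀ η : N.Run, N.IsTrace η →
      (∀ c ∈ l, TimedNet.Network.IsLive η c) →
      (∀ c ∈ s, TimedNet.Network.IsSync η c) →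
      (∀ c ∈ ef, TimedNet.Network.RespectsEdge η c) →
      ∀ m ∈ TimedNet.Network.rho η, m.IsModel (N.Phi l s ef)) ∧
    (∀ m : N.Model, m.IsModel (N.Phi l s ef) →
      N.IsTrace (TimedNet.Network.rhoInv m) ∧
      (∀ c ∈ l, TimedNet.Network.IsLive (TimedNet.Network.rhoInv m) c) ∧
      (∀ c ∈ s, TimedNet.Network.IsSync (TimedNet.Network.rhoInv m) c) ∧
      (∀ c ∈ ef, TimedNet.Network.RespectsEdge (TimedNet.Network.rhoInv m) c)) := by
  refine ⟨fun η hη hl hs hef m hm => TimedNet.Network.isModel_of_mem_rho hη hl hs hef hm,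
    fun m hm => ?_⟩
  obtain ⟨hN, hconds⟩ := (TimedNet.Network.isModel_Phi_iff m l s ef).1 hm
  exact ⟨TimedNet.Network.isTrace_rhoInv hN, hconds⟩
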